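/- Let $\mu\in\mathbb R$, $\sigma>0$, $\zeta\ge 0$, and let $\Pi$ be a $\sigma$-finite Borel measure on $(-\infty,0)$ with $\int_{-\infty}^0 x^2\,\Pi(dx)<\infty$ and $\int_{-\infty}^{-1}|x|e^{-\zeta x}\,\Pi(dx)<\infty$. For $\mathrm{Re}\,\lambda\ge-\zeta$ let $$\psi(\lambda)=\mu\lambda+\tfrac{\sigma^2}{2}\lambda^2+\int_{-\infty}^0\left(e^{\lambda x}-1-\lambda x\right)\Pi(dx)$$ be the Laplace exponent of the spectrally negative Lévy process with triplet $(\mu,\sigma,\Pi)$, and put $$k(\lambda,z)=\frac{\psi'(\lambda)}{\psi(\lambda)-\psi(-\zeta-iz)}-\frac{1}{\lambda+\zeta+iz}.$$ Then there is a constant $R_1>0$, depending only on $\mu,\sigma,\Pi,\zeta$, with the following properties. (a) There is $c'>0$ such that for all $v\ge R_1$ and all $u\in\mathbb R$: $\psi(v+iu)\ne\psi(-\zeta-iz)$ for every $z\in\mathbb R$, and $\int_{\mathbb R}|k(v+iu,z)|\,|f(z)|\,dz\le c'\,|v+iu|\,\min\left(\|f\|_{L^1(\mathbb R)},\|f\|_{L^2(\mathbb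 R)}\right)$ for every $f\in L^1(\mathbb R)\cup L^2(\mathbb R)$ (a norm being $+\infty$ when it is not finite). (b) For every $\gamma>R_1$ there are $c,r_0,R_0>0$ such that the following holds for every $h:\mathbb R\to\mathbb R$ that vanishes outside $(-\infty,0)$ and every $\hat h\in L^1(\mathbb R)$ with $e^{\zeta x}h(x)=\int_{\mathbb R}e^{-ixz}\hat h(z)\,dz$ for all $x\in\mathbb R$. Let $$g_r(x)=\frac1{2\pi}\int_{-r}^r e^{(\gamma+iu)x}\int_{\mathbb R}k(\gamma+iu,z)\hat h(z)\,dz\,du,\qquad g_{r,R}(x)=\frac1{2\pi}\int_{-r}^r e^{(\gamma+iu)x}\int_{-R}^{R}k(\gamma+iu,z)\hat h(z)\,dz\,du .$$ Let $\mathcal D$ be the space of $C^3$ functions $\phi:\mathbb R\to\mathbb R$ with $\sup_x|e^{kx}\phi^{(n)}(x)|<\infty$ for $n=0,1,2,3$ and $k=0,1,2,\dots$, with the topology of these seminorms, and let $\mathcal D^*$ be its dual. As $r\to\infty$, $g_r$ converges weakly in $\mathcal D^*$ to a generalized function (the weak symmetry image of $h$), whose restriction to $(0,\infty)$ is a continuous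 real function $g$; moreover $g(x)=\lim_{r\to\infty}g_r(x)$ for every $x>0$, and for all $r\ge r_0$, all $R\ge R_0$ and all $x>0$ $$|g(x)-g_{r,R}(x)|\le c\,\frac{e^{\gamma x}}{x}\left(\frac1r\|\hat h\|_{L^1(\mathbb R)}+\int_{|z|>\min(r/2,R)}|\hat h(z)|\,dz\right).$$ -/

import Mathlib

open MeasureTheory Filter Topology Set

noncomputable section

namespace WeakReflection

/-- Standing assumption on the triplet `(m, σ, ν)` of a spectrally negative Lévy process and on the
exponent `ζ`: `σ > 0`, `ζ ≥ 0`, and the Lévy measure `ν` is a σ-finite Borel measure carried by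
`(-∞, 0)` with `∫ x² ν(dx) < ∞` and `∫_{-∞}^{-1} |x| e^{-ζ x} ν(dx) < ∞`. -/
structure LevyAssumption (m σ ζ : ℝ) (ν : Measure ℝ) : Prop where
  sigma_pos : 0 < σ
  zeta_nonneg : 0 ≤ ζ
  sigmaFinite : SigmaFinite ν
  carrier : ν (Ici 0) = 0
  sq_integrable : IntegrableOn (fun x : ℝ => x ^ 2) (Iio 0) ν
  exp_integrable : IntegrableOn (fun x : ℝ => |x| * Real.exp (-ζ * x)) (Iic (-1)) ν

/-- The Laplace exponent
`ψ(l) = m l + (σ² / 2) l² + ∫_{(-∞,0)} (e^{l x} - 1 - l x) ν(dx)` at a complex argument `l`. -/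
def laplaceExponent (m σ : ℝ) (ν : Measure ℝ) (l : ℂ) : ℂ :=
  (m : ℂ) * l + (σ : ℂ) ^ 2 / 2 * l ^ 2
    + ∫ x in Iio (0 : ℝ), (Complex.exp (l * (x : ℂ)) - 1 - l * (x : ℂ)) ∂ν

/-- Standing assumption on the payoff: `h` vanishes outside `(-∞, 0)`, `hhat` is integrable, and
`e^{ζ x} h(x) = ∫ e^{-i x z} hhat(z) dz` for every real `x`. -/
structure PayoffAssumption (ζ : ℝ) (h : ℝ → ℝ) (hhat : ℝ → ℂ) : Prop where
  support_subset : Function.support h ⊆ Iio 0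
  integrable : Integrable hhat
  fourier : ∀ x : ℝ, ((Real.exp (ζ * x) * h x : ℝ) : ℂ)
    = ∫ z : ℝ, Complex.exp (-(Complex.I * (x : ℂ) * (z : ℂ))) * hhat z

/-- The kernel `ψ'(l) / (ψ(l) - ψ(-ζ - i z)) - 1 / (l + ζ + i z)`. -/
def kernel (ψ : ℂ → ℂ) (ζ : ℝ) (l : ℂ) (z : ℝ) : ℂ :=
  deriv ψ l / (ψ l - ψ (-(ζ : ℂ) - Complex.I * (z : ℂ)))
    - 1 / (l + (ζ : ℂ) + Complex.I * (z : ℂ))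

/-- `R₁` is an admissible abscissa: on the closed half plane `Re ≥ R₁` the denominators of the
kernel do not vanish, and
`∫ |kernel(v + i u, z)| |f(z)| dz ≤ c |v + i u| (‖f‖_{L¹} ∧ ‖f‖_{L²})` for all `f ∈ L¹ ∪ L²`,
with one constant `c`. -/
def IsAdmissibleAbscissa (ψ : ℂ → ℂ) (ζ R₁ : ℝ) : Prop :=
  0 < R₁ ∧ ∃ c : ℝ, 0 < c ∧ ∀ v : ℝ, R₁ ≤ v → ∀ u : ℝ,
    (∀ z : ℝ, ψ ((v : ℂ) + Complex.I * (u : ℂ)) ≠ ψ (-(ζ : ℂ) - Complex.I * (z : ℂ))) ∧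
    ∀ f : ℝ → ℂ, (MemLp f 1 volume ∨ MemLp f 2 volume) →
      ∫⁻ z : ℝ, ‖kernel ψ ζ ((v : ℂ) + Complex.I * (u : ℂ)) z‖ₑ * ‖f z‖ₑ
        ≤ ENNReal.ofReal (c * ‖(v : ℂ) + Complex.I * (u : ℂ)‖)
          * min (eLpNorm f 1 volume) (eLpNorm f 2 volume)

/-- The truncated Bromwich integral `g_r(x)`: `u` runs over `[-r, r]`, `z` over `ℝ`. -/
def truncU (ψ : ℂ → ℂ) (ζ γ : ℝ) (hhat : ℝ → ℂ) (r x : ℝ) : ℂ :=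
  (1 / (2 * (Real.pi : ℂ))) * ∫ u in (-r)..r,
    Complex.exp (((γ : ℂ) + Complex.I * (u : ℂ)) * (x : ℂ))
      * ∫ z : ℝ, kernel ψ ζ ((γ : ℂ) + Complex.I * (u : ℂ)) z * hhat z

/-- The doubly truncated integral `g_{r,R}(x)`: `u` runs over `[-r, r]`, `z` over `[-R, R]`. -/
def truncUZ (ψ : ℂ → ℂ) (ζ γ : ℝ) (hhat : ℝ → ℂ) (r R x : ℝ) : ℂ :=
  (1 / (2 * (Real.pi : ℂ))) * ∫ u in (-r)..r,
    Complex.exp (((γ : ℂ) + Complex.I * (u : ℂ)) * (x : ℂ))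
      * ∫ z in (-R)..R, kernel ψ ζ ((γ : ℂ) + Complex.I * (u : ℂ)) z * hhat z

/-- The space `𝒟` of test functions: three times continuously differentiable `f : ℝ → ℝ` with
`sup_x |e^{k x} f^{(n)}(x)| < ∞` for `n = 0, 1, 2, 3` and `k = 0, 1, 2, …`. -/
def testSpace : Submodule ℝ (ℝ → ℝ) where
  carrier := {f | ContDiff ℝ 3 f ∧ ∀ k n : ℕ, n ≤ 3 →
    BddAbove (range fun x : ℝ => |Real.exp (k * x) * iteratedDeriv n f x|)}
  zero_mem' := by
    refine ⟨contDiff_const, fun k n _ => ⟨0, ?_⟩⟩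
    rintro _ ⟨x, rfl⟩
    have hz : iteratedDeriv n (0 : ℝ → ℝ) x = 0 := by
      have h1 : (0 : ℝ → ℝ) = fun _ => (0 : ℝ) := rfl
      rw [h1, iteratedDeriv_const]
      split_ifs <;> rfl
    simp [hz]
  add_mem' := by
    rintro f g ⟨hf, hf'⟩ ⟨hg, hg'⟩
    refine ⟨hf.add hg, fun k n hn => ?_⟩
    obtain ⟨a, ha⟩ := hf' k n hn
    obtain ⟨b, hb⟩ := hg' k n hn
    refine ⟨a + b, ?_⟩
    rintro _ ⟨x, rfl⟩
    have hn' : (n : WithTop ℕ∞) ≤ 3 := by exact_mod_cast hn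
    have h1 : iteratedDeriv n (f + g) x = iteratedDeriv n f x + iteratedDeriv n g x :=
      iteratedDeriv_add (hf.of_le hn').contDiffAt (hg.of_le hn').contDiffAt
    have h2 := ha ⟨x, rfl⟩
    have h3 := hb ⟨x, rfl⟩
    simp only [h1, mul_add] at h2 h3 ⊢
    exact (abs_add_le _ _).trans (add_le_add h2 h3)
  smul_mem' := by
    rintro c f ⟨hf, hf'⟩
    refine ⟨hf.const_smul c, fun k n hn => ?_⟩
    obtain ⟨a, ha⟩ := hf' k n hn
    refine ⟨|c| * a, ?_⟩
    rintro _ ⟨x, rfl⟩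
    have hn' : (n : WithTop ℕ∞) ≤ 3 := by exact_mod_cast hn
    have h1 : iteratedDeriv n (c • f) x = c • iteratedDeriv n f x :=
      iteratedDeriv_const_smul (hf.of_le hn').contDiffAt c
    have h2 := ha ⟨x, rfl⟩
    simp only [h1, smul_eq_mul] at h2 ⊢
    rw [mul_left_comm, abs_mul]
    exact mul_le_mul_of_nonneg_left h2 (abs_nonneg c)

/-- The seminorm `sup_x |e^{k x} f^{(n)}(x)|` on `𝒟`. -/
def testSeminorm (k n : ℕ) (f : testSpace) : ℝ :=
  ⨆ x : ℝ, |Real.exp (k * x) * iteratedDeriv n (f : ℝ → ℝ) x|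

/-- Membership in the dual `𝒟*`: the linear functional `G` is continuous for the topology generated
by the seminorms `testSeminorm k n`, `n ≤ 3`; that is, it is dominated by finitely many of them. -/
def IsContinuousFunctional (G : testSpace →ₗ[ℝ] ℝ) : Prop :=
  ∃ (N : ℕ) (C : ℝ), ∀ f : testSpace,
    |G f| ≤ C * ∑ k ∈ Finset.range (N + 1), ∑ n ∈ Finset.range 4, testSeminorm k n f

/-- `g` is (the function representing on `(0, ∞)`) the image
`(1 / 2π) ∫ e^{(γ + i u) x} ∫ kernel(γ + i u, z) hhat(z) dz du` of the payoff, the integral over `u`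
being the limit of `g_r` as `r → ∞`. The functions `g_r` converge weakly in `𝒟*` to a generalized
function `G`, the restriction of `G` to `(0, ∞)` is the function `g`, which is continuous there, and
`g_r(x) → g(x)` for every `x > 0`. The values of `g` on `(-∞, 0]` are irrelevant. -/
def IsWeakSymmetryImage (ψ : ℂ → ℂ) (ζ γ : ℝ) (hhat : ℝ → ℂ) (g : ℝ → ℝ) : Prop :=
  ContinuousOn g (Ioi 0) ∧
  (∀ x : ℝ, 0 < x → Tendsto (fun r : ℝ => truncU ψ ζ γ hhat r x) atTop (𝓝 (g x : ℂ))) ∧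
  ∃ G : testSpace →ₗ[ℝ] ℝ, IsContinuousFunctional G ∧
    (∀ f : testSpace,
      (∀ r : ℝ, 0 < r → Integrable fun x : ℝ => truncU ψ ζ γ hhat r x * ((f : ℝ → ℝ) x : ℂ)) ∧
      Tendsto (fun r : ℝ => ∫ x : ℝ, truncU ψ ζ γ hhat r x * ((f : ℝ → ℝ) x : ℂ)) atTop
        (𝓝 (G f : ℂ))) ∧
    ∀ f : testSpace, HasCompactSupport (f : ℝ → ℝ) → tsupport (f : ℝ → ℝ) ⊆ Ioi 0 →
      G f = ∫ x : ℝ, g x * (f : ℝ → ℝ) x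

end WeakReflection

end

/-!
Write `p = -ζ - i z` and let `F(l) = (ψ(l) - ψ(p)) / (l - p)` be the secant slope. The kernel is its
logarithmic derivative, `kernel = N / F` with `N = F' = (ψ'(l) - F(l)) / (l - p)`, and
`N' = (ψ'' - 2 N) / (l - p)`. Everything is read off from a few estimates for `F` and `N`, in which
the Lévy measure enters only through the tilted truncated moment
`Λ(T) = ∫ min(T x², |x|) e^{-ζ x} ν(dx)`; by dominated convergence `Λ(T) = o(T)`
(`LevyAssumption.exists_truncatedMoment_le`). On a half plane `Re l ≥ R₁` one has `Re F ≥ 1`, so the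
denominator of the kernel never vanishes; `F = (σ² / 2)(l + p) + o(|l| + |p|)`; `N` and `ψ''` are
bounded; and `N → σ² / 2` as `|l - p| → ∞`. These are collected in `SecantBounds` and proved in
`LevyAssumption.exists_secantBounds`.

For the integral bound it is enough that `|kernel| ≤ C` and `|kernel| ≤ C |l| / √(1 + z²)`, the second
because `|F|` grows like `|z|` when `|z|` is large compared with `|l|`.

For the inversion, fix `γ > R₁` and consider `k(u) = kernel(γ + i u, z)`. Then `|k'|` is dominated by
`|l - p|⁻² + |F|⁻²`. The first term has a bounded integral. So has the second: where `|l - p|` is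
bounded it is at most a multiple of the first, because `|F| ≥ 1`; where `|l - p|` is large,
`Im F` moves along the line with speed at least `σ² / 4`, and `|F|² ≥ 1 + (Im F)²`, so that `|F|⁻²` is
dominated by the derivative of a multiple of `arctan (Im F)`
(`SecantBounds.exists_variation_bound`). Hence `k` has total variation bounded uniformly in `z`, and
one integration by parts bounds `∫_a^b e^{(γ + i u) x} k(u) du` by a multiple of `e^{γ x} / x`. On
`|u| ≥ r` with `2 |z| ≤ r` one has `k = O(1 / u)` and `k' = O(1 / u²)`, which gains a factor `1 / r`
(`SecantBounds.exists_oscillatoryKernel`). Fubini's theorem turns these bounds into the Cauchy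
property of the truncated inversions, locally uniformly on `(0, ∞)`, and into the error estimate.

Weak convergence is easier: two integrations by parts make the two-sided Laplace transform of a test
function `O(1 / u²)` on `Re = γ`, so it is absolutely integrable against the bounded function
`∫ kernel(γ + i u, z) hhat(z) dz`. The limits are real because `hhat(-z)` and `conj (hhat(z))` have
the same Fourier integral and therefore agree almost everywhere.
-/

namespace WeakReflection

/-! ### Increments of the exponential function -/

lemma norm_exp_sub_exp_le {a b : ℂ} {M : ℝ} (ha : a.re ≤ M) (hb : b.re ≤ M) :
    ‖Complex.exp b - Complex.exp a‖ ≤ Real.exp M * ‖b - a‖ := by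
  refine Convex.norm_image_sub_le_of_norm_deriv_le (s := {y : ℂ | y.re ≤ M})
    (fun y _ => Complex.differentiable_exp.differentiableAt) (fun y hy => ?_)
    (convex_halfSpace_re_le M) ha hb
  rw [Complex.deriv_exp, Complex.norm_exp]
  exact Real.exp_le_exp.mpr hy

/-- The increment of `exp` compared with the linear increment of slope `e^c`: the remainder is of
second order when `c` is close to `a` and `b`, and always at most of first order. The cases `c = a`
and `c = 0` give the integrand bounds for the Laplace exponent and its secant slopes. -/
lemma norm_exp_sub_exp_sub_le {a b c : ℂ} {M : ℝ} (ha : a.re ≤ M) (hb : b.re ≤ M)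
    (hc : c.re ≤ M) :
    ‖Complex.exp b - Complex.exp a - Complex.exp c * (b - a)‖
      ≤ Real.exp M * min (‖a - c‖ + ‖b - c‖) 2 * ‖b - a‖ := by
  have key : ∀ y ∈ {y : ℂ | y.re ≤ M} ∩ Metric.closedBall c (‖a - c‖ + ‖b - c‖),
      ‖Complex.exp y - Complex.exp c‖ ≤ Real.exp M * min (‖a - c‖ + ‖b - c‖) 2 := by
    rintro y ⟨hy, hy'⟩
    rw [Metric.mem_closedBall, dist_eq_norm] at hy'
    rw [mul_min_of_nonneg _ _ (Real.exp_pos M).le]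
    refine le_min ((norm_exp_sub_exp_le hc hy).trans
      (mul_le_mul_of_nonneg_left hy' (Real.exp_pos M).le)) ?_
    refine (norm_sub_le _ _).trans ?_
    rw [Complex.norm_exp, Complex.norm_exp]
    have h1 := Real.exp_le_exp.mpr hy
    have h2 := Real.exp_le_exp.mpr hc
    linarith
  have h := Convex.norm_image_sub_le_of_norm_hasDerivWithin_le
    (f := fun y => Complex.exp y - Complex.exp c * y)
    (f' := fun y => Complex.exp y - Complex.exp c)
    (s := {y : ℂ | y.re ≤ M} ∩ Metric.closedBall c (‖a - c‖ + ‖b - c‖)) (x := a) (y := b)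
    (fun y _ => by
      have h1 := (Complex.hasDerivAt_exp y).sub ((hasDerivAt_id y).const_mul (Complex.exp c))
      exact (h1.congr_deriv (by simp)).hasDerivWithinAt)
    key ((convex_halfSpace_re_le M).inter (convex_closedBall _ _))
    ⟨ha, by simp [dist_eq_norm]⟩ ⟨hb, by simp [dist_eq_norm]⟩
  refine le_trans (le_of_eq ?_) h
  congr 1
  ring

lemma exp_sub_one_le_min_mul_exp (t : ℝ) :
    Real.exp t - 1 ≤ min t 1 * Real.exp t := by
  rw [min_mul_of_nonneg _ _ (Real.exp_pos t).le]
  refine le_min ?_ (by linarith)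
  have h1 := Real.add_one_le_exp (-t)
  have h2 : Real.exp (-t) * Real.exp t = 1 := by rw [← Real.exp_add]; simp
  nlinarith [Real.exp_pos t]

/-! ### Tilted truncated moments of the Lévy measure -/

/-- The truncated moment `∫_{(-∞,0)} min(T x², |x|) e^{-ζ x} ν(dx)`, which controls every increment
of the Laplace exponent over a distance comparable to `T`. -/
noncomputable def truncatedMoment (ζ : ℝ) (ν : Measure ℝ) (T : ℝ) : ℝ :=
  ∫ x in Iio (0 : ℝ), min (T * x ^ 2) |x| * Real.exp (-ζ * x) ∂ν

section LaplaceExponent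

variable {m σ ζ : ℝ} {ν : Measure ℝ}

lemma LevyAssumption.integrableOn_min (hX : LevyAssumption m σ ζ ν) {T : ℝ} (hT : 0 ≤ T) :
    IntegrableOn (fun x : ℝ => min (T * x ^ 2) |x| * Real.exp (-ζ * x)) (Iio 0) ν := by
  have hmeas : Measurable fun x : ℝ => min (T * x ^ 2) |x| * Real.exp (-ζ * x) := by fun_prop
  have hnn : ∀ x : ℝ, 0 ≤ min (T * x ^ 2) |x| := fun x => le_min (by positivity) (abs_nonneg x)
  have hU : Iio (0 : ℝ) = Iic (-1) ∪ Ioo (-1) 0 := by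
    ext x; simp only [mem_Iio, mem_union, mem_Iic, mem_Ioo]
    constructor
    · intro h; rcases le_or_gt x (-1) with h' | h'
      · exact Or.inl h'
      · exact Or.inr ⟨h', h⟩
    · rintro (h | h)
      · linarith
      · exact h.2
  rw [hU]
  refine IntegrableOn.union ?_ ?_
  · refine Integrable.mono' hX.exp_integrable hmeas.aestronglyMeasurable
      (Eventually.of_forall fun x => ?_)
    rw [Real.norm_of_nonneg (mul_nonneg (hnn x) (Real.exp_pos _).le)]
    exact mul_le_mul_of_nonneg_right (min_le_right _ _) (Real.exp_pos _).le
  · have h1 : IntegrableOn (fun x : ℝ => T * Real.exp ζ * x ^ 2) (Ioo (-1) 0) ν :=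
      (hX.sq_integrable.mono_set Ioo_subset_Iio_self).const_mul _
    refine Integrable.mono' h1 hmeas.aestronglyMeasurable ?_
    filter_upwards [ae_restrict_mem measurableSet_Ioo] with x hx
    rw [Real.norm_of_nonneg (mul_nonneg (hnn x) (Real.exp_pos _).le)]
    have h2 : Real.exp (-ζ * x) ≤ Real.exp ζ := by
      apply Real.exp_le_exp.mpr
      nlinarith [hX.zeta_nonneg, hx.1]
    calc min (T * x ^ 2) |x| * Real.exp (-ζ * x) ≤ (T * x ^ 2) * Real.exp ζ :=
          mul_le_mul (min_le_left _ _) h2 (Real.exp_pos _).le (by positivity)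
      _ = _ := by ring

lemma truncatedMoment_nonneg {T : ℝ} (hT : 0 ≤ T) : 0 ≤ truncatedMoment ζ ν T :=
  integral_nonneg fun x =>
    mul_nonneg (le_min (by positivity) (abs_nonneg x)) (Real.exp_pos _).le

lemma LevyAssumption.truncatedMoment_mono (hX : LevyAssumption m σ ζ ν) {S T : ℝ} (hS : 0 ≤ S)
    (h : S ≤ T) : truncatedMoment ζ ν S ≤ truncatedMoment ζ ν T := by
  refine integral_mono (hX.integrableOn_min hS) (hX.integrableOn_min (hS.trans h)) fun x => ?_
  have : S * x ^ 2 ≤ T * x ^ 2 := mul_le_mul_of_nonneg_right h (sq_nonneg x)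
  exact mul_le_mul_of_nonneg_right (min_le_min_right _ this) (Real.exp_pos _).le

/-- The truncated moment is sublinear in `T`: by dominated convergence
`∫ min(x², |x| / T) e^{-ζ x} ν(dx) → 0` as `T → ∞`. -/
lemma LevyAssumption.exists_truncatedMoment_le (hX : LevyAssumption m σ ζ ν) {ε : ℝ}
    (hε : 0 < ε) : ∃ C : ℝ, 0 ≤ C ∧ ∀ T : ℝ, 0 ≤ T → truncatedMoment ζ ν T ≤ ε * T + C := by
  have hlim : Tendsto (fun T : ℝ => ∫ x in Iio (0 : ℝ),
      T⁻¹ * (min (T * x ^ 2) |x| * Real.exp (-ζ * x)) ∂ν) atTop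
      (𝓝 (∫ x in Iio (0 : ℝ), (0 : ℝ) ∂ν)) := by
    refine tendsto_integral_filter_of_dominated_convergence
      (fun x => min (1 * x ^ 2) |x| * Real.exp (-ζ * x)) ?_ ?_
      (hX.integrableOn_min zero_le_one) ?_
    · refine Eventually.of_forall fun T => Measurable.aestronglyMeasurable ?_
      fun_prop
    · filter_upwards [eventually_ge_atTop (1 : ℝ)] with T hT
      refine Eventually.of_forall fun x => ?_
      have hT0 : 0 < T := by linarith
      have h0 : 0 ≤ min (T * x ^ 2) |x| := le_min (by positivity) (abs_nonneg x)
      rw [Real.norm_of_nonneg (by positivity), ← mul_assoc]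
      refine mul_le_mul_of_nonneg_right ?_ (Real.exp_pos _).le
      rw [mul_min_of_nonneg _ _ (inv_nonneg.mpr hT0.le)]
      refine min_le_min (le_of_eq (by field_simp)) ?_
      exact mul_le_of_le_one_left (abs_nonneg x) (inv_le_one_of_one_le₀ hT)
    · refine Eventually.of_forall fun x => ?_
      have h1 : Tendsto (fun T : ℝ => T⁻¹ * (|x| * Real.exp (-ζ * x))) atTop (𝓝 0) := by
        simpa using tendsto_inv_atTop_zero.mul_const (|x| * Real.exp (-ζ * x))
      refine tendsto_of_tendsto_of_tendsto_of_le_of_le' tendsto_const_nhds h1 ?_ ?_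
      · filter_upwards [eventually_ge_atTop (1 : ℝ)] with T hT
        have h0 : 0 ≤ min (T * x ^ 2) |x| := le_min (by positivity) (abs_nonneg x)
        positivity
      · filter_upwards [eventually_ge_atTop (1 : ℝ)] with T hT
        gcongr
        exact min_le_right _ _
  rw [integral_zero] at hlim
  obtain ⟨T₀, hT₀⟩ := eventually_atTop.mp
    ((hlim.eventually_le_const hε).and (eventually_ge_atTop (1 : ℝ)))
  have hT₀1 : 1 ≤ T₀ := (hT₀ T₀ le_rfl).2
  refine ⟨truncatedMoment ζ ν T₀, truncatedMoment_nonneg (by linarith), fun T hT => ?_⟩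
  rcases le_total T T₀ with h | h
  · have := hX.truncatedMoment_mono hT h
    nlinarith
  · have h1 := (hT₀ T h).1
    rw [integral_const_mul] at h1
    change T⁻¹ * truncatedMoment ζ ν T ≤ ε at h1
    have hTpos : 0 < T := by linarith
    rw [inv_mul_le_iff₀ hTpos] at h1
    have := truncatedMoment_nonneg (ζ := ζ) (ν := ν) (T := T₀) (by linarith)
    linarith

/-! ### The Laplace exponent and its derivatives -/

lemma re_mul_ofReal_le {l : ℂ} (hl : -ζ ≤ l.re) {x : ℝ} (hx : x ≤ 0) :
    (l * (x : ℂ)).re ≤ -ζ * x := by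
  rw [Complex.re_mul_ofReal]
  nlinarith

lemma abs_mul_min_le {T : ℝ} (hT : 0 ≤ T) (x : ℝ) :
    min (T * |x|) 2 * |x| ≤ 2 * min (T * x ^ 2) |x| := by
  rw [mul_min_of_nonneg _ _ zero_le_two, min_mul_of_nonneg _ _ (abs_nonneg x)]
  refine min_le_min ?_ le_rfl
  have : 0 ≤ T * x ^ 2 := by positivity
  rw [mul_assoc, ← sq, sq_abs]
  linarith

/-- Increments of `y ↦ e^{y x}`, compared with a linear function of slope `x e^{q x}`. -/
lemma norm_exp_increment_le {l p q : ℂ}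
    (hl : -ζ ≤ l.re) (hp : -ζ ≤ p.re) (hq : -ζ ≤ q.re) {x : ℝ} (hx : x < 0) :
    ‖Complex.exp (l * x) - Complex.exp (p * x) - Complex.exp (q * x) * ((l - p) * x)‖
      ≤ 2 * ‖l - p‖ * (min ((‖p - q‖ + ‖l - q‖) * x ^ 2) |x| * Real.exp (-ζ * x)) := by
  have h := norm_exp_sub_exp_sub_le (re_mul_ofReal_le hp hx.le) (re_mul_ofReal_le hl hx.le)
    (re_mul_ofReal_le hq hx.le)
  simp only [← sub_mul, norm_mul, Complex.norm_real, Real.norm_eq_abs, ← add_mul] at h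
  refine h.trans ?_
  have h2 := abs_mul_min_le (T := ‖p - q‖ + ‖l - q‖) (by positivity) x
  calc _ = Real.exp (-ζ * x) * ‖l - p‖ * (min ((‖p - q‖ + ‖l - q‖) * |x|) 2 * |x|) := by ring
    _ ≤ Real.exp (-ζ * x) * ‖l - p‖ * (2 * min ((‖p - q‖ + ‖l - q‖) * x ^ 2) |x|) := by gcongr
    _ = _ := by ring

lemma LevyAssumption.integrableOn_exp_increment (hX : LevyAssumption m σ ζ ν) {l p q : ℂ}
    (hl : -ζ ≤ l.re) (hp : -ζ ≤ p.re) (hq : -ζ ≤ q.re) :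
    IntegrableOn (fun x : ℝ => Complex.exp (l * x) - Complex.exp (p * x)
      - Complex.exp (q * x) * ((l - p) * x)) (Iio 0) ν := by
  refine Integrable.mono' ((hX.integrableOn_min (T := ‖p - q‖ + ‖l - q‖)
    (by positivity)).const_mul (2 * ‖l - p‖)) ?_ ?_
  · exact Continuous.aestronglyMeasurable (by fun_prop)
  · filter_upwards [ae_restrict_mem measurableSet_Iio] with x hx
    exact norm_exp_increment_le hl hp hq hx

lemma LevyAssumption.norm_integral_exp_increment_le (hX : LevyAssumption m σ ζ ν) {l p q : ℂ}
    (hl : -ζ ≤ l.re) (hp : -ζ ≤ p.re) (hq : -ζ ≤ q.re) :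
    ‖∫ x in Iio (0 : ℝ), (Complex.exp (l * x) - Complex.exp (p * x)
      - Complex.exp (q * x) * ((l - p) * x)) ∂ν‖
      ≤ 2 * ‖l - p‖ * truncatedMoment ζ ν (‖p - q‖ + ‖l - q‖) := by
  rw [truncatedMoment, ← integral_const_mul]
  refine norm_integral_le_of_norm_le ((hX.integrableOn_min (T := ‖p - q‖ + ‖l - q‖)
    (by positivity)).const_mul (2 * ‖l - p‖)) ?_
  filter_upwards [ae_restrict_mem measurableSet_Iio] with x hx
  exact norm_exp_increment_le hl hp hq hx

lemma LevyAssumption.integrableOn_exponent (hX : LevyAssumption m σ ζ ν) {l : ℂ}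
    (hl : -ζ ≤ l.re) :
    IntegrableOn (fun x : ℝ => Complex.exp (l * x) - 1 - l * x) (Iio 0) ν := by
  have h0 : -ζ ≤ (0 : ℂ).re := by simpa using hX.zeta_nonneg
  simpa using hX.integrableOn_exp_increment hl h0 h0

/-- The secant slope `(ψ(l) - ψ(p)) / (l - p)`. -/
noncomputable def secant (ψ : ℂ → ℂ) (p l : ℂ) : ℂ := (ψ l - ψ p) / (l - p)

/-- The derivative `(ψ'(l) - (ψ(l) - ψ(p)) / (l - p)) / (l - p)` in `l` of the secant slope. -/
noncomputable def secantDeriv (ψ : ℂ → ℂ) (p l : ℂ) : ℂ :=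
  (deriv ψ l - secant ψ p l) / (l - p)

lemma LevyAssumption.exponent_sub (hX : LevyAssumption m σ ζ ν) {l p : ℂ}
    (hl : -ζ ≤ l.re) (hp : -ζ ≤ p.re) :
    laplaceExponent m σ ν l - laplaceExponent m σ ν p
      = (l - p) * (m + (σ : ℂ) ^ 2 / 2 * (l + p))
        + ∫ x in Iio (0 : ℝ), (Complex.exp (l * x) - Complex.exp (p * x) - (l - p) * x) ∂ν := by
  have h := integral_sub (hX.integrableOn_exponent hl) (hX.integrableOn_exponent hp)
  have h2 : ∀ x : ℝ, Complex.exp (l * x) - 1 - l * x - (Complex.exp (p * x) - 1 - p * x)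
      = Complex.exp (l * x) - Complex.exp (p * x) - (l - p) * x := fun x => by ring
  simp only [h2] at h
  rw [h, laplaceExponent, laplaceExponent]
  ring

/-- The jump part contributes to the secant slope only a term sublinear in `|l| + |p|`. -/
lemma LevyAssumption.norm_secant_sub_le (hX : LevyAssumption m σ ζ ν) {l p : ℂ}
    (hl : -ζ ≤ l.re) (hp : -ζ ≤ p.re) (hne : l - p ≠ 0) :
    ‖secant (laplaceExponent m σ ν) p l - (m + (σ : ℂ) ^ 2 / 2 * (l + p))‖
      ≤ 2 * truncatedMoment ζ ν (‖p‖ + ‖l‖) := by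
  have h0 : -ζ ≤ (0 : ℂ).re := by simpa using hX.zeta_nonneg
  have h := hX.norm_integral_exp_increment_le hl hp h0
  simp only [zero_mul, Complex.exp_zero, one_mul, sub_zero] at h
  have hpos : 0 < ‖l - p‖ := norm_pos_iff.mpr hne
  have h1 : secant (laplaceExponent m σ ν) p l - (m + (σ : ℂ) ^ 2 / 2 * (l + p))
      = (∫ x in Iio (0 : ℝ), (Complex.exp (l * x) - Complex.exp (p * x) - (l - p) * x) ∂ν)
        / (l - p) := by
    rw [secant, hX.exponent_sub hl hp]
    field_simp
    ring
  rw [h1, norm_div, div_le_iff₀ hpos]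
  linarith

/-- A one-sided bound for the secant slope, linear in `Re l + Re p` with an error independent of `l`
and `p`: the jump integrand is `x (A - 1)` with `A = (e^{l x} - e^{p x}) / ((l - p) x)`, and since
`x < 0` and `|A| ≤ e^{-ζ x}`, its real part is at least `-|x| (e^{-ζ x} - 1)`. -/
lemma LevyAssumption.le_re_secant (hX : LevyAssumption m σ ζ ν) {l p : ℂ}
    (hl : -ζ ≤ l.re) (hp : -ζ ≤ p.re) (hne : l - p ≠ 0) :
    m + σ ^ 2 / 2 * (l.re + p.re) - truncatedMoment ζ ν ζ
      ≤ (secant (laplaceExponent m σ ν) p l).re := by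
  have hI : IntegrableOn (fun x : ℝ =>
      (Complex.exp (l * x) - Complex.exp (p * x) - (l - p) * x) / (l - p)) (Iio 0) ν := by
    have h0 : -ζ ≤ (0 : ℂ).re := by simpa using hX.zeta_nonneg
    have h := hX.integrableOn_exp_increment hl hp h0
    simp only [zero_mul, Complex.exp_zero, one_mul] at h
    exact h.div_const _
  have h1 : secant (laplaceExponent m σ ν) p l = (m + (σ : ℂ) ^ 2 / 2 * (l + p))
      + ∫ x in Iio (0 : ℝ),
        (Complex.exp (l * x) - Complex.exp (p * x) - (l - p) * x) / (l - p) ∂ν := by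
    rw [integral_div, secant, hX.exponent_sub hl hp]
    field_simp
  have h2 : (∫ x in Iio (0 : ℝ),
        (Complex.exp (l * x) - Complex.exp (p * x) - (l - p) * x) / (l - p) ∂ν).re
      = ∫ x in Iio (0 : ℝ),
        ((Complex.exp (l * x) - Complex.exp (p * x) - (l - p) * x) / (l - p)).re ∂ν :=
    (integral_re hI).symm
  have h3 : -truncatedMoment ζ ν ζ ≤ ∫ x in Iio (0 : ℝ),
        ((Complex.exp (l * x) - Complex.exp (p * x) - (l - p) * x) / (l - p)).re ∂ν := by
    rw [truncatedMoment, ← integral_neg]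
    refine integral_mono_ae (hX.integrableOn_min hX.zeta_nonneg).neg hI.re ?_
    filter_upwards [ae_restrict_mem measurableSet_Iio] with x hx
    have hx : x < 0 := hx
    have hW : 0 < ‖l - p‖ := norm_pos_iff.mpr hne
    have e1 : (Complex.exp (l * x) - Complex.exp (p * x) - (l - p) * x) / (l - p)
        = (Complex.exp (l * x) - Complex.exp (p * x)) / (l - p) - x := by
      field_simp
    have e2 : ‖(Complex.exp (l * x) - Complex.exp (p * x)) / (l - p)‖
        ≤ |x| * Real.exp (-ζ * x) := by
      rw [norm_div, div_le_iff₀ hW]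
      refine (norm_exp_sub_exp_le (re_mul_ofReal_le hp hx.le)
        (re_mul_ofReal_le hl hx.le)).trans (le_of_eq ?_)
      rw [← sub_mul, norm_mul, Complex.norm_real, Real.norm_eq_abs]
      ring
    have e3 := (abs_le.mp ((Complex.abs_re_le_norm _).trans e2)).1
    have e5 := mul_le_mul_of_nonneg_left (exp_sub_one_le_min_mul_exp (-ζ * x)) (abs_nonneg x)
    have e6 : |x| * (min (-ζ * x) 1 * Real.exp (-ζ * x))
        = min (ζ * x ^ 2) |x| * Real.exp (-ζ * x) := by
      rw [← mul_assoc, mul_min_of_nonneg _ _ (abs_nonneg x), abs_of_neg hx]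
      congr 2 <;> ring
    rw [e6, abs_of_neg hx] at e5
    rw [abs_of_neg hx] at e3
    change -(min (ζ * x ^ 2) |x| * Real.exp (-ζ * x))
      ≤ ((Complex.exp (l * x) - Complex.exp (p * x) - (l - p) * x) / (l - p)).re
    rw [e1, Complex.sub_re, Complex.ofReal_re, abs_of_neg hx]
    linarith
  have h4 : ((m : ℂ) + (σ : ℂ) ^ 2 / 2 * (l + p)).re = m + σ ^ 2 / 2 * (l.re + p.re) := by
    have : (σ : ℂ) ^ 2 / 2 = ((σ ^ 2 / 2 : ℝ) : ℂ) := by push_cast; ring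
    rw [this, Complex.add_re, Complex.re_ofReal_mul, Complex.ofReal_re, Complex.add_re]
  rw [h1, Complex.add_re, h2, h4]
  linarith

lemma LevyAssumption.hasDerivAt_exponent (hX : LevyAssumption m σ ζ ν) {l : ℂ} (hl : 0 < l.re) :
    HasDerivAt (laplaceExponent m σ ν)
      (m + (σ : ℂ) ^ 2 * l + ∫ x in Iio (0 : ℝ), (x : ℂ) * (Complex.exp (l * x) - 1) ∂ν) l := by
  have hs : {y : ℂ | 0 < y.re} ∩ Metric.ball l 1 ∈ 𝓝 l :=
    inter_mem ((isOpen_lt continuous_const Complex.continuous_re).mem_nhds hl)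
      (Metric.ball_mem_nhds l one_pos)
  have hζ := hX.zeta_nonneg
  have hJ := (hasDerivAt_integral_of_dominated_loc_of_deriv_le (μ := ν.restrict (Iio 0))
    (F := fun (y : ℂ) (x : ℝ) => Complex.exp (y * x) - 1 - y * x)
    (F' := fun (y : ℂ) (x : ℝ) => (x : ℂ) * (Complex.exp (y * x) - 1))
    (bound := fun x => (‖l‖ + 1) * x ^ 2) hs
    (Eventually.of_forall fun y => Continuous.aestronglyMeasurable (by fun_prop))
    (hX.integrableOn_exponent (by linarith))
    (Continuous.aestronglyMeasurable (by fun_prop)) ?_ (hX.sq_integrable.const_mul _) ?_).2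
  · have h1 : HasDerivAt (fun y : ℂ => (m : ℂ) * y + (σ : ℂ) ^ 2 / 2 * y ^ 2)
        (m + (σ : ℂ) ^ 2 * l) l := by
      have := ((hasDerivAt_id l).const_mul (m : ℂ)).add
        (((hasDerivAt_id l).pow 2).const_mul ((σ : ℂ) ^ 2 / 2))
      refine this.congr_deriv ?_
      simp
      ring
    exact h1.add hJ
  · filter_upwards [ae_restrict_mem measurableSet_Iio] with x hx y hy
    have hx : x < 0 := hx
    have hyr : (y * (x : ℂ)).re ≤ 0 := by
      rw [Complex.re_mul_ofReal]; exact mul_nonpos_of_nonneg_of_nonpos (le_of_lt hy.1) hx.le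
    have h1 := norm_exp_sub_exp_le (a := 0) (b := y * x) (M := 0) (by simp) hyr
    simp only [Complex.exp_zero, Real.exp_zero, one_mul, sub_zero, norm_mul,
      Complex.norm_real, Real.norm_eq_abs] at h1
    rw [norm_mul, Complex.norm_real, Real.norm_eq_abs]
    have h2 : ‖y‖ ≤ ‖l‖ + 1 := by
      have h3 := hy.2
      rw [Metric.mem_ball, dist_eq_norm] at h3
      have := norm_le_norm_add_norm_sub l y
      rw [norm_sub_rev] at h3
      linarith
    calc |x| * ‖Complex.exp (y * x) - 1‖ ≤ |x| * ((‖l‖ + 1) * |x|) := by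
          gcongr
          exact h1.trans (mul_le_mul_of_nonneg_right h2 (abs_nonneg x))
      _ = (‖l‖ + 1) * x ^ 2 := by rw [← sq_abs x]; ring
  · refine Eventually.of_forall fun x y _ => ?_
    have h1 : HasDerivAt (fun y : ℂ => y * (x : ℂ)) x y := by
      simpa using (hasDerivAt_id y).mul_const (x : ℂ)
    refine ((h1.cexp.sub_const 1).sub h1).congr_deriv ?_
    ring

lemma LevyAssumption.deriv_exponent (hX : LevyAssumption m σ ζ ν) {l : ℂ} (hl : 0 < l.re) :
    deriv (laplaceExponent m σ ν) l
      = m + (σ : ℂ) ^ 2 * l + ∫ x in Iio (0 : ℝ), (x : ℂ) * (Complex.exp (l * x) - 1) ∂ν :=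
  (hX.hasDerivAt_exponent hl).deriv

lemma LevyAssumption.integrableOn_deriv (hX : LevyAssumption m σ ζ ν) {l : ℂ} (hl : 0 < l.re) :
    IntegrableOn (fun x : ℝ => (x : ℂ) * (Complex.exp (l * x) - 1)) (Iio 0) ν := by
  refine Integrable.mono' (hX.sq_integrable.const_mul ‖l‖)
    (Continuous.aestronglyMeasurable (by fun_prop)) ?_
  filter_upwards [ae_restrict_mem measurableSet_Iio] with x hx
  have hx : x < 0 := hx
  have hyr : (l * (x : ℂ)).re ≤ 0 := by
    rw [Complex.re_mul_ofReal]; exact mul_nonpos_of_nonneg_of_nonpos hl.le hx.le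
  have h1 := norm_exp_sub_exp_le (a := 0) (b := l * x) (M := 0) (by simp) hyr
  simp only [Complex.exp_zero, Real.exp_zero, one_mul, sub_zero, norm_mul,
    Complex.norm_real, Real.norm_eq_abs] at h1
  rw [norm_mul, Complex.norm_real, Real.norm_eq_abs]
  calc |x| * ‖Complex.exp (l * x) - 1‖ ≤ |x| * (‖l‖ * |x|) := by gcongr
    _ = ‖l‖ * x ^ 2 := by rw [← sq_abs x]; ring

lemma LevyAssumption.hasDerivAt_deriv_exponent (hX : LevyAssumption m σ ζ ν) {l : ℂ}
    (hl : 0 < l.re) :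
    HasDerivAt (deriv (laplaceExponent m σ ν))
      ((σ : ℂ) ^ 2 + ∫ x in Iio (0 : ℝ), (x : ℂ) ^ 2 * Complex.exp (l * x) ∂ν) l := by
  have hs : {y : ℂ | 0 < y.re} ∈ 𝓝 l :=
    (isOpen_lt continuous_const Complex.continuous_re).mem_nhds hl
  have hJ := (hasDerivAt_integral_of_dominated_loc_of_deriv_le (μ := ν.restrict (Iio 0))
    (F := fun (y : ℂ) (x : ℝ) => (x : ℂ) * (Complex.exp (y * x) - 1))
    (F' := fun (y : ℂ) (x : ℝ) => (x : ℂ) ^ 2 * Complex.exp (y * x))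
    (bound := fun x => x ^ 2) hs
    (Eventually.of_forall fun y => Continuous.aestronglyMeasurable (by fun_prop))
    (hX.integrableOn_deriv hl)
    (Continuous.aestronglyMeasurable (by fun_prop)) ?_ hX.sq_integrable ?_).2
  · have h1 : HasDerivAt (fun y : ℂ => (m : ℂ) + (σ : ℂ) ^ 2 * y) ((σ : ℂ) ^ 2) l := by
      simpa using ((hasDerivAt_id l).const_mul ((σ : ℂ) ^ 2)).const_add (m : ℂ)
    refine (h1.add hJ).congr_of_eventuallyEq ?_
    filter_upwards [hs] with y hy
    exact hX.deriv_exponent hy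
  · filter_upwards [ae_restrict_mem measurableSet_Iio] with x hx y hy
    rw [norm_mul, Complex.norm_exp, Complex.re_mul_ofReal, norm_pow, Complex.norm_real,
      Real.norm_eq_abs, sq_abs]
    refine mul_le_of_le_one_right (sq_nonneg x) (Real.exp_le_one_iff.mpr ?_)
    exact mul_nonpos_of_nonneg_of_nonpos (le_of_lt hy) (le_of_lt hx)
  · refine Eventually.of_forall fun x y _ => ?_
    have h1 : HasDerivAt (fun y : ℂ => y * (x : ℂ)) x y := by
      simpa using (hasDerivAt_id y).mul_const (x : ℂ)
    refine ((h1.cexp.sub_const 1).const_mul (x : ℂ)).congr_deriv ?_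
    ring

lemma LevyAssumption.norm_deriv_deriv_exponent_le (hX : LevyAssumption m σ ζ ν) {l : ℂ}
    (hl : 0 < l.re) :
    ‖deriv (deriv (laplaceExponent m σ ν)) l‖ ≤ σ ^ 2 + ∫ x in Iio (0 : ℝ), x ^ 2 ∂ν := by
  rw [(hX.hasDerivAt_deriv_exponent hl).deriv]
  refine (norm_add_le _ _).trans (add_le_add (le_of_eq ?_) ?_)
  · rw [norm_pow, Complex.norm_real, Real.norm_eq_abs, sq_abs]
  · refine norm_integral_le_of_norm_le hX.sq_integrable ?_
    filter_upwards [ae_restrict_mem measurableSet_Iio] with x hx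
    rw [norm_mul, Complex.norm_exp, Complex.re_mul_ofReal, norm_pow, Complex.norm_real,
      Real.norm_eq_abs, sq_abs]
    refine mul_le_of_le_one_right (sq_nonneg x) (Real.exp_le_one_iff.mpr ?_)
    exact mul_nonpos_of_nonneg_of_nonpos hl.le (le_of_lt hx)

/-- The derivative of the secant slope is `σ² / 2` up to an error that tends to `0` as
`|l - p| → ∞`. -/
lemma LevyAssumption.norm_secantDeriv_sub_le (hX : LevyAssumption m σ ζ ν) {l p : ℂ}
    (hl : 0 < l.re) (hp : -ζ ≤ p.re) (hne : l - p ≠ 0) :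
    ‖secantDeriv (laplaceExponent m σ ν) p l - (σ : ℂ) ^ 2 / 2‖ * ‖l - p‖
      ≤ 2 * truncatedMoment ζ ν ‖l - p‖ := by
  have hl' : -ζ ≤ l.re := by linarith [hX.zeta_nonneg]
  have h := hX.norm_integral_exp_increment_le hp hl' hl'
  rw [sub_self, norm_zero, zero_add, norm_sub_rev p l] at h
  have h0 : -ζ ≤ (0 : ℂ).re := by simpa using hX.zeta_nonneg
  have i1 := hX.integrableOn_exp_increment hl' hp h0
  simp only [zero_mul, Complex.exp_zero, one_mul] at i1
  have h1 := integral_sub ((hX.integrableOn_deriv hl).const_mul (l - p)) i1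
  have e : ∀ x : ℝ, (l - p) * ((x : ℂ) * (Complex.exp (l * x) - 1))
      - (Complex.exp (l * x) - Complex.exp (p * x) - (l - p) * x)
      = Complex.exp (p * x) - Complex.exp (l * x) - Complex.exp (l * x) * ((p - l) * x) :=
    fun x => by ring
  simp only [e] at h1
  have h2 : (secantDeriv (laplaceExponent m σ ν) p l - (σ : ℂ) ^ 2 / 2) * (l - p) ^ 2
      = ∫ x in Iio (0 : ℝ), (Complex.exp (p * x) - Complex.exp (l * x)
        - Complex.exp (l * x) * ((p - l) * x)) ∂ν := by
    rw [h1, integral_const_mul, secantDeriv, secant, hX.exponent_sub hl' hp,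
      hX.deriv_exponent hl]
    field_simp
    ring
  have hW : 0 < ‖l - p‖ := norm_pos_iff.mpr hne
  rw [← h2, norm_mul, norm_pow] at h
  refine le_of_mul_le_mul_right ?_ hW
  calc _ = _ := by ring
    _ ≤ _ := h
    _ = _ := by ring

lemma LevyAssumption.continuousOn_exponent (hX : LevyAssumption m σ ζ ν) :
    ContinuousOn (laplaceExponent m σ ν) {l : ℂ | -ζ ≤ l.re} := by
  have h0 : -ζ ≤ (0 : ℂ).re := by simpa using hX.zeta_nonneg
  refine ContinuousOn.add (by fun_prop) fun l hl => ?_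
  refine continuousWithinAt_of_dominated
    (bound := fun x => 2 * (‖l‖ + 1) * (min ((‖l‖ + 1) * x ^ 2) |x| * Real.exp (-ζ * x)))
    (Eventually.of_forall fun y => Continuous.aestronglyMeasurable (by fun_prop)) ?_
    ((hX.integrableOn_min (by positivity)).const_mul _)
    (Eventually.of_forall fun x => Continuous.continuousWithinAt (by fun_prop))
  filter_upwards [self_mem_nhdsWithin, mem_nhdsWithin_of_mem_nhds (Metric.ball_mem_nhds l one_pos)]
    with y hy hy'
  filter_upwards [ae_restrict_mem measurableSet_Iio] with x hx
  have h := norm_exp_increment_le hy h0 h0 hx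
  simp only [zero_mul, Complex.exp_zero, one_mul, sub_zero, norm_zero, zero_add] at h
  refine h.trans ?_
  have h2 : ‖y‖ ≤ ‖l‖ + 1 := by
    rw [Metric.mem_ball, dist_eq_norm, norm_sub_rev] at hy'
    have := norm_le_norm_add_norm_sub l y
    linarith
  have : 0 ≤ min (‖y‖ * x ^ 2) |x| := le_min (by positivity) (abs_nonneg x)
  gcongr

lemma laplaceExponent_conj (l : ℂ) :
    laplaceExponent m σ ν ((starRingEnd ℂ) l) = (starRingEnd ℂ) (laplaceExponent m σ ν l) := by
  simp only [laplaceExponent, map_add, map_mul, map_pow, map_div₀, Complex.conj_ofReal,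
    ← integral_conj, map_sub, ← Complex.exp_conj, map_one, Complex.conj_ofNat]

end LaplaceExponent

/-! ### Secant slopes between a half plane and the line `Re = -ζ` -/

/-- The point `-ζ - i z` of the line `Re = -ζ`. -/
noncomputable def tiltPoint (ζ z : ℝ) : ℂ := -(ζ : ℂ) - Complex.I * (z : ℂ)

lemma re_tiltPoint (ζ z : ℝ) : (tiltPoint ζ z).re = -ζ := by simp [tiltPoint]

lemma im_tiltPoint (ζ z : ℝ) : (tiltPoint ζ z).im = -z := by simp [tiltPoint]

lemma continuous_tiltPoint (ζ : ℝ) : Continuous (tiltPoint ζ) := by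
  unfold tiltPoint; fun_prop

/-- What the analysis of the kernel uses about the exponent `ψ`: regularity, symmetry, and estimates
for the secant slopes between points `l` with `Re l ≥ R` and points of the line `Re = -ζ`. The
number `s` stands for `σ² / 2`; `C` and `K` are the constants in the estimates. -/
structure SecantBounds (ψ : ℂ → ℂ) (ζ s R C K : ℝ) : Prop where
  zeta_nonneg : 0 ≤ ζ
  s_pos : 0 < s
  one_le_R : 1 ≤ R
  one_le_C : 1 ≤ C
  one_le_K : 1 ≤ K
  conj : ∀ l, ψ ((starRingEnd ℂ) l) = (starRingEnd ℂ) (ψ l)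
  continuous_line : Continuous fun z => ψ (tiltPoint ζ z)
  differentiableAt : ∀ l : ℂ, R ≤ l.re → DifferentiableAt ℂ ψ l
  differentiableAt_deriv : ∀ l : ℂ, R ≤ l.re → DifferentiableAt ℂ (deriv ψ) l
  deriv_deriv_le : ∀ l : ℂ, R ≤ l.re → ‖deriv (deriv ψ) l‖ ≤ C
  one_le_re_secant : ∀ l : ℂ, R ≤ l.re → ∀ z, 1 ≤ (secant ψ (tiltPoint ζ z) l).re
  secant_sub_le : ∀ l : ℂ, R ≤ l.re → ∀ z,
    ‖secant ψ (tiltPoint ζ z) l - s * (l + tiltPoint ζ z)‖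
      ≤ s / 8 * (‖l‖ + ‖tiltPoint ζ z‖) + C
  secantDeriv_le : ∀ l : ℂ, R ≤ l.re → ∀ z, ‖secantDeriv ψ (tiltPoint ζ z) l‖ ≤ C
  le_re_secantDeriv : ∀ l : ℂ, R ≤ l.re → ∀ z, K ≤ ‖l - tiltPoint ζ z‖ →
    s / 2 ≤ (secantDeriv ψ (tiltPoint ζ z) l).re

lemma one_le_norm_sub_tiltPoint {ζ : ℝ} (hζ : 0 ≤ ζ) {l : ℂ} (hl : 1 ≤ l.re) (z : ℝ) :
    1 ≤ ‖l - tiltPoint ζ z‖ := by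
  have h := Complex.abs_re_le_norm (l - tiltPoint ζ z)
  rw [Complex.sub_re, re_tiltPoint] at h
  exact le_trans (by linarith [le_abs_self (l.re - -ζ)]) h

lemma LevyAssumption.exists_secantBounds {m σ ζ : ℝ} {ν : Measure ℝ}
    (hX : LevyAssumption m σ ζ ν) :
    ∃ R C K : ℝ, SecantBounds (laplaceExponent m σ ν) ζ (σ ^ 2 / 2) R C K := by
  have hσ := hX.sigma_pos
  have hζ := hX.zeta_nonneg
  have hs : 0 < σ ^ 2 / 2 := by positivity
  obtain ⟨C₁, hC₁, hM₁⟩ := hX.exists_truncatedMoment_le (ε := σ ^ 2 / 32) (by positivity)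
  set B := σ ^ 2 + ∫ x in Iio (0 : ℝ), x ^ 2 ∂ν with hB
  have hB0 : 0 ≤ ∫ x in Iio (0 : ℝ), x ^ 2 ∂ν := integral_nonneg fun x => sq_nonneg x
  have hΛ := truncatedMoment_nonneg (ζ := ζ) (ν := ν) hζ
  -- the abscissa that makes `m + (σ² / 2) (Re l - ζ) - Λ(ζ)` at least `1`
  set R := 1 + ζ + (|m| + truncatedMoment ζ ν ζ + 1) / (σ ^ 2 / 2) with hR
  have hR1 : 1 ≤ R := by
    have : 0 ≤ (|m| + truncatedMoment ζ ν ζ + 1) / (σ ^ 2 / 2) := by positivity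
    linarith
  have hre : ∀ z, -ζ ≤ (tiltPoint ζ z).re := fun z => (re_tiltPoint ζ z).ge
  have hne : ∀ l : ℂ, R ≤ l.re → ∀ z, l - tiltPoint ζ z ≠ 0 := fun l hl z =>
    norm_pos_iff.mp (lt_of_lt_of_le one_pos (one_le_norm_sub_tiltPoint hζ (hR1.trans hl) z))
  have hN : ∀ l : ℂ, R ≤ l.re → ∀ z,
      ‖secantDeriv (laplaceExponent m σ ν) (tiltPoint ζ z) l - (σ : ℂ) ^ 2 / 2‖
        * ‖l - tiltPoint ζ z‖ ≤ σ ^ 2 / 16 * ‖l - tiltPoint ζ z‖ + 2 * C₁ := fun l hl z => by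
    have h1 := hX.norm_secantDeriv_sub_le (by linarith) (hre z) (hne l hl z)
    have h2 := hM₁ ‖l - tiltPoint ζ z‖ (norm_nonneg _)
    linarith
  have hs' : (σ : ℂ) ^ 2 / 2 = ((σ ^ 2 / 2 : ℝ) : ℂ) := by push_cast; ring
  refine ⟨R, 1 + B + |m| + 2 * C₁ + σ ^ 2, 1 + 16 * C₁ / σ ^ 2, hζ, hs, hR1, ?_, ?_,
    laplaceExponent_conj, ?_, ?_, ?_, ?_, ?_, ?_, ?_, ?_⟩
  · have := abs_nonneg m; nlinarith [sq_nonneg σ]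
  · have : 0 ≤ 16 * C₁ / σ ^ 2 := by positivity
    linarith
  · exact hX.continuousOn_exponent.comp_continuous (continuous_tiltPoint ζ) hre
  · exact fun l hl => (hX.hasDerivAt_exponent (by linarith)).differentiableAt
  · exact fun l hl => (hX.hasDerivAt_deriv_exponent (by linarith)).differentiableAt
  · intro l hl
    have := hX.norm_deriv_deriv_exponent_le (l := l) (by linarith)
    have h2 := abs_nonneg m
    nlinarith [sq_nonneg σ]
  · intro l hl z
    have h := hX.le_re_secant (by linarith) (hre z) (hne l hl z)
    rw [re_tiltPoint] at h
    refine le_trans ?_ h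
    have h1 : σ ^ 2 / 2 * (R - ζ) ≤ σ ^ 2 / 2 * (l.re + -ζ) :=
      mul_le_mul_of_nonneg_left (by linarith) hs.le
    have h2 : σ ^ 2 / 2 * (R - ζ) = σ ^ 2 / 2 + (|m| + truncatedMoment ζ ν ζ + 1) := by
      rw [hR]; field_simp; ring
    linarith [neg_abs_le m]
  · intro l hl z
    have h1 := hX.norm_secant_sub_le (by linarith) (hre z) (hne l hl z)
    have h2 := hM₁ (‖tiltPoint ζ z‖ + ‖l‖) (by positivity)
    have h3 : secant (laplaceExponent m σ ν) (tiltPoint ζ z) l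
          - ((σ ^ 2 / 2 : ℝ) : ℂ) * (l + tiltPoint ζ z)
        = (secant (laplaceExponent m σ ν) (tiltPoint ζ z) l
          - (m + (σ : ℂ) ^ 2 / 2 * (l + tiltPoint ζ z))) + (m : ℂ) := by
      rw [hs']; ring
    rw [h3]
    refine (norm_add_le _ _).trans ?_
    rw [Complex.norm_real, Real.norm_eq_abs]
    nlinarith [sq_nonneg σ]
  · intro l hl z
    have h1 := hN l hl z
    have hW := one_le_norm_sub_tiltPoint hζ (hR1.trans hl) z
    have h2 : ‖secantDeriv (laplaceExponent m σ ν) (tiltPoint ζ z) l - (σ : ℂ) ^ 2 / 2‖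
        ≤ σ ^ 2 / 16 + 2 * C₁ := by
      refine le_of_mul_le_mul_right (h1.trans ?_) (lt_of_lt_of_le one_pos hW)
      nlinarith
    have h3 := norm_le_norm_add_norm_sub' (secantDeriv (laplaceExponent m σ ν) (tiltPoint ζ z) l)
      ((σ : ℂ) ^ 2 / 2)
    have h4 : ‖(σ : ℂ) ^ 2 / 2‖ = σ ^ 2 / 2 := by
      rw [hs', Complex.norm_real, Real.norm_of_nonneg hs.le]
    have h5 := abs_nonneg m
    nlinarith [sq_nonneg σ]
  · intro l hl z hK
    have h1 := hN l hl z
    have hW := one_le_norm_sub_tiltPoint hζ (hR1.trans hl) z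
    have h2 : ‖secantDeriv (laplaceExponent m σ ν) (tiltPoint ζ z) l - (σ : ℂ) ^ 2 / 2‖
        ≤ σ ^ 2 / 4 := by
      refine le_of_mul_le_mul_right (h1.trans ?_) (lt_of_lt_of_le one_pos hW)
      have h6 : 16 * C₁ / σ ^ 2 ≤ ‖l - tiltPoint ζ z‖ := by linarith
      rw [div_le_iff₀ (by positivity)] at h6
      nlinarith
    have h3 := (abs_le.mp ((Complex.abs_re_le_norm _).trans h2)).1
    rw [hs', Complex.sub_re, Complex.ofReal_re] at h3
    linarith

/-! ### Size and variation of the kernel -/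

namespace SecantBounds

variable {ψ : ℂ → ℂ} {ζ s R C K : ℝ}

lemma sub_ne_zero (B : SecantBounds ψ ζ s R C K) {l : ℂ} (hl : R ≤ l.re) (z : ℝ) :
    l - tiltPoint ζ z ≠ 0 :=
  norm_pos_iff.mp (lt_of_lt_of_le one_pos
    (one_le_norm_sub_tiltPoint B.zeta_nonneg (B.one_le_R.trans hl) z))

lemma one_le_norm_secant (B : SecantBounds ψ ζ s R C K) {l : ℂ} (hl : R ≤ l.re) (z : ℝ) :
    1 ≤ ‖secant ψ (tiltPoint ζ z) l‖ :=
  (B.one_le_re_secant l hl z).trans (Complex.re_le_norm _)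

lemma secant_ne_zero (B : SecantBounds ψ ζ s R C K) {l : ℂ} (hl : R ≤ l.re) (z : ℝ) :
    secant ψ (tiltPoint ζ z) l ≠ 0 :=
  norm_pos_iff.mp (lt_of_lt_of_le one_pos (B.one_le_norm_secant hl z))

lemma exponent_sub_ne_zero (B : SecantBounds ψ ζ s R C K) {l : ℂ} (hl : R ≤ l.re) (z : ℝ) :
    ψ l - ψ (tiltPoint ζ z) ≠ 0 := fun h => by
  refine B.secant_ne_zero hl z ?_
  rw [secant, h, zero_div]

/-- The kernel is the logarithmic derivative in `l` of the secant slope. -/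
lemma kernel_eq (B : SecantBounds ψ ζ s R C K) {l : ℂ} (hl : R ≤ l.re) (z : ℝ) :
    kernel ψ ζ l z = secantDeriv ψ (tiltPoint ζ z) l / secant ψ (tiltPoint ζ z) l := by
  have h1 := B.sub_ne_zero hl z
  have h2 := B.exponent_sub_ne_zero hl z
  have h3 : l + (ζ : ℂ) + Complex.I * (z : ℂ) = l - tiltPoint ζ z := by
    rw [tiltPoint]; ring
  rw [kernel, h3, secantDeriv, secant]
  change deriv ψ l / (ψ l - ψ (tiltPoint ζ z)) - _ = _
  field_simp

lemma norm_kernel_le_div (B : SecantBounds ψ ζ s R C K) {l : ℂ} (hl : R ≤ l.re) (z : ℝ) :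
    ‖kernel ψ ζ l z‖ ≤ C / ‖secant ψ (tiltPoint ζ z) l‖ := by
  rw [B.kernel_eq hl, norm_div]
  exact div_le_div_of_nonneg_right (B.secantDeriv_le l hl z) (norm_nonneg _)

lemma norm_kernel_le (B : SecantBounds ψ ζ s R C K) {l : ℂ} (hl : R ≤ l.re) (z : ℝ) :
    ‖kernel ψ ζ l z‖ ≤ C :=
  (B.norm_kernel_le_div hl z).trans
    (div_le_self (by linarith [B.one_le_C]) (B.one_le_norm_secant hl z))

lemma hasDerivAt_secant (B : SecantBounds ψ ζ s R C K) {l : ℂ} (hl : R ≤ l.re) (z : ℝ) :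
    HasDerivAt (secant ψ (tiltPoint ζ z)) (secantDeriv ψ (tiltPoint ζ z) l) l := by
  have h1 := B.sub_ne_zero hl z
  refine (((B.differentiableAt l hl).hasDerivAt.sub_const (ψ (tiltPoint ζ z))).div
    ((hasDerivAt_id l).sub_const (tiltPoint ζ z)) h1).congr_deriv ?_
  simp only [secantDeriv, secant, id]
  field_simp

lemma hasDerivAt_secantDeriv (B : SecantBounds ψ ζ s R C K) {l : ℂ} (hl : R ≤ l.re) (z : ℝ) :
    HasDerivAt (secantDeriv ψ (tiltPoint ζ z))
      ((deriv (deriv ψ) l - 2 * secantDeriv ψ (tiltPoint ζ z) l) / (l - tiltPoint ζ z)) l := by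
  have h1 := B.sub_ne_zero hl z
  refine (((B.differentiableAt_deriv l hl).hasDerivAt.sub (B.hasDerivAt_secant hl z)).div
    ((hasDerivAt_id l).sub_const (tiltPoint ζ z)) h1).congr_deriv ?_
  have h2 : deriv ψ l - secant ψ (tiltPoint ζ z) l
      = secantDeriv ψ (tiltPoint ζ z) l * (l - tiltPoint ζ z) := by
    rw [secantDeriv, div_mul_cancel₀ _ h1]
  simp only [id, Pi.sub_apply, h2]
  field_simp
  ring

/-- The kernel is differentiable in `l`, and its derivative is dominated by
`|l - p|⁻² + |F|⁻²`, where `p = -ζ - i z` and `F` is the secant slope. -/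
lemma exists_hasDerivAt_kernel (B : SecantBounds ψ ζ s R C K) {l : ℂ} (hl : R < l.re) (z : ℝ) :
    ∃ k' : ℂ, HasDerivAt (fun y => kernel ψ ζ y z) k' l ∧
      ‖k'‖ ≤ 4 * C ^ 2 * (1 / ‖l - tiltPoint ζ z‖ ^ 2
        + 1 / ‖secant ψ (tiltPoint ζ z) l‖ ^ 2) := by
  set W := l - tiltPoint ζ z with hWdef
  set F := secant ψ (tiltPoint ζ z) l with hFdef
  set N := secantDeriv ψ (tiltPoint ζ z) l with hNdef
  have hW : W ≠ 0 := B.sub_ne_zero hl.le z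
  have hF : F ≠ 0 := B.secant_ne_zero hl.le z
  have hW' : 0 < ‖W‖ := norm_pos_iff.mpr hW
  have hF' : 0 < ‖F‖ := norm_pos_iff.mpr hF
  have hC := B.one_le_C
  refine ⟨(deriv (deriv ψ) l - 2 * N) / W / F - N ^ 2 / F ^ 2, ?_, ?_⟩
  · refine HasDerivAt.congr_of_eventuallyEq (f := fun y =>
      secantDeriv ψ (tiltPoint ζ z) y / secant ψ (tiltPoint ζ z) y) ?_ ?_
    · refine ((B.hasDerivAt_secantDeriv hl.le z).div (B.hasDerivAt_secant hl.le z)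
        hF).congr_deriv ?_
      simp only [← hWdef, ← hFdef, ← hNdef]
      field_simp
    · filter_upwards [(isOpen_lt continuous_const Complex.continuous_re).mem_nhds hl] with y hy
      exact B.kernel_eq (le_of_lt hy) z
  · have hN : ‖N‖ ≤ C := B.secantDeriv_le l hl.le z
    have h1 : ‖deriv (deriv ψ) l - 2 * N‖ ≤ 3 * C := by
      refine (norm_sub_le _ _).trans ?_
      rw [norm_mul, Complex.norm_ofNat]
      linarith [B.deriv_deriv_le l hl.le]
    have h2 : ‖N‖ ^ 2 ≤ C ^ 2 := pow_le_pow_left₀ (norm_nonneg _) hN 2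
    refine (norm_sub_le _ _).trans ?_
    rw [norm_div, norm_div, norm_div, norm_pow, norm_pow]
    have h3 : ‖deriv (deriv ψ) l - 2 * N‖ / ‖W‖ / ‖F‖ ≤ 3 * C * (1 / ‖W‖ * (1 / ‖F‖)) := by
      rw [div_div, div_eq_mul_one_div, one_div_mul_one_div]
      exact mul_le_mul_of_nonneg_right h1 (by positivity)
    have h4 : ‖N‖ ^ 2 / ‖F‖ ^ 2 ≤ C ^ 2 * (1 / ‖F‖) ^ 2 := by
      rw [div_pow, one_pow, div_eq_mul_one_div]
      exact mul_le_mul_of_nonneg_right h2 (by positivity)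
    rw [← one_div_pow, ← one_div_pow]
    have h5 : 0 < 1 / ‖W‖ := by positivity
    have h6 : 0 < 1 / ‖F‖ := by positivity
    set a := 1 / ‖W‖
    set b := 1 / ‖F‖
    have h7 : 3 * C * (a * b) ≤ 3 * C ^ 2 * (a * b) := by
      have : C ≤ C ^ 2 := by nlinarith
      have hab : 0 < a * b := mul_pos h5 h6
      nlinarith
    have h8 : a * b ≤ (a ^ 2 + b ^ 2) / 2 := by nlinarith [sq_nonneg (a - b)]
    nlinarith [mul_le_mul_of_nonneg_left h8 (sq_nonneg C), sq_nonneg a, sq_nonneg b,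
      mul_nonneg (sq_nonneg C) (sq_nonneg a)]

lemma continuous_kernel (B : SecantBounds ψ ζ s R C K) {v : ℝ} (hv : R ≤ v) :
    Continuous fun q : ℝ × ℝ => kernel ψ ζ ((v : ℂ) + Complex.I * (q.1 : ℂ)) q.2 := by
  have hre : ∀ u : ℝ, R ≤ ((v : ℂ) + Complex.I * (u : ℂ)).re := fun u => by simpa using hv
  have hline : Continuous fun u : ℝ => (v : ℂ) + Complex.I * (u : ℂ) := by fun_prop
  have h1 : Continuous fun u : ℝ => ψ ((v : ℂ) + Complex.I * (u : ℂ)) :=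
    continuous_iff_continuousAt.mpr fun u =>
      ContinuousAt.comp (g := ψ) (B.differentiableAt _ (hre u)).continuousAt hline.continuousAt
  have h2 : Continuous fun u : ℝ => deriv ψ ((v : ℂ) + Complex.I * (u : ℂ)) :=
    continuous_iff_continuousAt.mpr fun u =>
      ContinuousAt.comp (g := deriv ψ) (B.differentiableAt_deriv _ (hre u)).continuousAt
        hline.continuousAt
  have h3 := B.continuous_line
  unfold kernel
  refine Continuous.sub (Continuous.div (h2.comp continuous_fst)
    ((h1.comp continuous_fst).sub (h3.comp continuous_snd))
    fun q => B.exponent_sub_ne_zero (hre q.1) q.2) (Continuous.div (by fun_prop) (by fun_prop)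
    fun q => ?_)
  have h4 := B.sub_ne_zero (hre q.1) q.2
  rw [tiltPoint] at h4
  intro h5
  exact h4 (by linear_combination h5)

lemma kernel_neg_neg (B : SecantBounds ψ ζ s R C K) {v : ℝ} (hv : R ≤ v) (u z : ℝ) :
    kernel ψ ζ ((v : ℂ) + Complex.I * ((-u : ℝ) : ℂ)) (-z)
      = (starRingEnd ℂ) (kernel ψ ζ ((v : ℂ) + Complex.I * (u : ℂ)) z) := by
  have hre : R ≤ ((v : ℂ) + Complex.I * (u : ℂ)).re := by simpa using hv
  have h1 : (v : ℂ) + Complex.I * ((-u : ℝ) : ℂ)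
      = (starRingEnd ℂ) ((v : ℂ) + Complex.I * (u : ℂ)) := by simp
  have h2 : deriv ψ ((starRingEnd ℂ) ((v : ℂ) + Complex.I * (u : ℂ)))
      = (starRingEnd ℂ) (deriv ψ ((v : ℂ) + Complex.I * (u : ℂ))) := by
    have h3 := (B.differentiableAt _ hre).hasDerivAt.conj_conj
    have h4 : (starRingEnd ℂ) ∘ ψ ∘ (starRingEnd ℂ) = ψ := by
      funext l
      simp only [Function.comp_apply, B.conj, Complex.conj_conj]
    rw [h4] at h3
    exact h3.deriv
  have h5 : -(ζ : ℂ) - Complex.I * ((-z : ℝ) : ℂ)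
      = (starRingEnd ℂ) (-(ζ : ℂ) - Complex.I * (z : ℂ)) := by simp
  rw [kernel, kernel, h1, h2, h5, B.conj, B.conj]
  simp

/-- Along vertical lines the kernel has total variation bounded uniformly in `z`. The primitive
dominating it is a combination of `arctan (Im F)` and `arctan (u + z)`: away from `u = -z` the slope
`F` has vertical speed at least `s / 2`, while `Re F ≥ 1`. -/
lemma exists_variation_bound (B : SecantBounds ψ ζ s R C K) :
    ∃ D : ℝ, 0 < D ∧ ∀ γ : ℝ, R < γ → ∀ z : ℝ, ∃ Φ Φ' : ℝ → ℝ, (∀ u, HasDerivAt Φ (Φ' u) u) ∧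
      (∀ u, |Φ u| ≤ D) ∧ ∀ u : ℝ, ∃ k' : ℂ,
        HasDerivAt (fun u : ℝ => kernel ψ ζ ((γ : ℂ) + Complex.I * (u : ℂ)) z) k' u ∧
        ‖k'‖ ≤ Φ' u := by
  have hC := B.one_le_C
  have hs := B.s_pos
  have hK := B.one_le_K
  have hR := B.one_le_R
  have hζ := B.zeta_nonneg
  set a := 2 / s with ha
  set b := 1 + (1 + a * C) * K ^ 2 with hb
  have ha0 : 0 < a := by positivity
  have hb0 : 0 < b := by positivity
  refine ⟨4 * C ^ 2 * ((a + b) * 2), by positivity, fun γ hγ z => ?_⟩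
  set F : ℝ → ℂ := fun u => secant ψ (tiltPoint ζ z) ((γ : ℂ) + Complex.I * (u : ℂ)) with hF
  set N : ℝ → ℂ := fun u => secantDeriv ψ (tiltPoint ζ z) ((γ : ℂ) + Complex.I * (u : ℂ)) with hN
  have hre : ∀ u : ℝ, R < ((γ : ℂ) + Complex.I * (u : ℂ)).re := fun u => by simpa using hγ
  have hline : ∀ u : ℝ, HasDerivAt (fun u : ℝ => (γ : ℂ) + Complex.I * (u : ℂ)) Complex.I u :=
    fun u => by
      simpa using ((Complex.ofRealCLM.hasDerivAt (x := u)).const_mul Complex.I).const_add (γ : ℂ)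
  have hIm : ∀ u : ℝ, HasDerivAt (fun u => (F u).im) (N u).re u := fun u => by
    have h1 : HasDerivAt F (N u * Complex.I) u :=
      HasDerivAt.comp (h₂ := secant ψ (tiltPoint ζ z)) u (B.hasDerivAt_secant (hre u).le z) (hline u)
    have h2 := (Complex.imCLM.hasFDerivAt.comp_hasDerivAt u h1)
    refine h2.congr_deriv ?_
    simp
  refine ⟨fun u => 4 * C ^ 2 * (a * Real.arctan (F u).im + b * Real.arctan (u + z)),
    fun u => 4 * C ^ 2 * (a * (1 / (1 + (F u).im ^ 2) * (N u).re)
      + b * (1 / (1 + (u + z) ^ 2) * 1)), fun u => ?_, fun u => ?_, fun u => ?_⟩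
  · exact (((hIm u).arctan.const_mul a).add
      ((((hasDerivAt_id u).add_const z).arctan).const_mul b)).const_mul _
  · have h1 : ∀ t, |Real.arctan t| ≤ 2 := fun t => by
      rw [abs_le]
      constructor <;> linarith [Real.neg_pi_div_two_lt_arctan t, Real.arctan_lt_pi_div_two t,
        Real.pi_le_four]
    rw [abs_mul, abs_of_pos (by positivity : 0 < 4 * C ^ 2)]
    refine mul_le_mul_of_nonneg_left ?_ (by positivity)
    refine (abs_add_le _ _).trans ?_
    rw [abs_mul, abs_mul, abs_of_pos ha0, abs_of_pos hb0]
    have h2 := mul_le_mul_of_nonneg_left (h1 (F u).im) ha0.le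
    have h3 := mul_le_mul_of_nonneg_left (h1 (u + z)) hb0.le
    linarith
  · obtain ⟨k', hk', hle⟩ := B.exists_hasDerivAt_kernel (hre u) z
    refine ⟨k' * Complex.I, HasDerivAt.comp (h₂ := fun y => kernel ψ ζ y z) u hk' (hline u), ?_⟩
    rw [norm_mul, Complex.norm_I, mul_one]
    refine hle.trans (mul_le_mul_of_nonneg_left ?_ (by positivity))
    have hW2 : ‖(γ : ℂ) + Complex.I * (u : ℂ) - tiltPoint ζ z‖ ^ 2 = (γ + ζ) ^ 2 + (u + z) ^ 2 := by
      rw [Complex.sq_norm, Complex.normSq_apply]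
      simp [re_tiltPoint, im_tiltPoint]
      ring
    have hF2 : ‖F u‖ ^ 2 = (F u).re ^ 2 + (F u).im ^ 2 := by
      rw [Complex.sq_norm, Complex.normSq_apply]; ring
    have hFre : 1 ≤ (F u).re := B.one_le_re_secant _ (hre u).le z
    have hN1 : ‖N u‖ ≤ C := B.secantDeriv_le _ (hre u).le z
    have hW3 : 1 + (u + z) ^ 2 ≤ ‖(γ : ℂ) + Complex.I * (u : ℂ) - tiltPoint ζ z‖ ^ 2 := by
      rw [hW2]; nlinarith
    have e1 : 1 / ‖(γ : ℂ) + Complex.I * (u : ℂ) - tiltPoint ζ z‖ ^ 2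
        ≤ 1 / (1 + (u + z) ^ 2) := one_div_le_one_div_of_le (by positivity) hW3
    have e2 : 1 / ‖F u‖ ^ 2 ≤ 1 / (1 + (F u).im ^ 2) :=
      one_div_le_one_div_of_le (by positivity) (by rw [hF2]; nlinarith)
    have e3 : 1 / (1 + (F u).im ^ 2) ≤ 1 := by
      rw [div_le_one (by positivity)]; nlinarith [sq_nonneg (F u).im]
    have e4 : 0 < 1 / (1 + (F u).im ^ 2) := by positivity
    have e5 : 0 < 1 / (1 + (u + z) ^ 2) := by positivity
    suffices h : 1 / (1 + (F u).im ^ 2) ≤ a * (1 / (1 + (F u).im ^ 2) * (N u).re)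
        + (1 + a * C) * K ^ 2 * (1 / (1 + (u + z) ^ 2)) by
      rw [hb]; linarith
    rcases le_or_gt K ‖(γ : ℂ) + Complex.I * (u : ℂ) - tiltPoint ζ z‖ with hWK | hWK
    · have h1 : s / 2 ≤ (N u).re := B.le_re_secantDeriv _ (hre u).le z hWK
      have h2 : 1 ≤ a * (N u).re := by
        calc (1 : ℝ) = a * (s / 2) := by rw [ha]; field_simp
          _ ≤ _ := mul_le_mul_of_nonneg_left h1 ha0.le
      have h3 : 0 ≤ (1 + a * C) * K ^ 2 * (1 / (1 + (u + z) ^ 2)) := by positivity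
      nlinarith
    · have h1 : 1 + (u + z) ^ 2 ≤ K ^ 2 :=
        hW3.trans (pow_le_pow_left₀ (norm_nonneg _) hWK.le 2)
      have h2 : 1 ≤ K ^ 2 * (1 / (1 + (u + z) ^ 2)) := by
        rw [mul_one_div, le_div_iff₀ (by positivity)]; linarith
      have h3 : -C ≤ (N u).re := (abs_le.mp ((Complex.abs_re_le_norm _).trans hN1)).1
      have h4 : 1 / (1 + (F u).im ^ 2) * (1 - a * (N u).re) ≤ 1 + a * C := by
        have : 1 - a * (N u).re ≤ 1 + a * C := by nlinarith
        have h0 : 0 ≤ 1 + a * C := by positivity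
        nlinarith
      have h5 : 1 + a * C ≤ (1 + a * C) * (K ^ 2 * (1 / (1 + (u + z) ^ 2))) :=
        le_mul_of_one_le_right (by positivity) h2
      linarith

/-- For `|u|` large and `2 |z| ≤ |u|` the secant slope is at least a multiple of `|u|`. -/
lemma exists_le_norm_secant (B : SecantBounds ψ ζ s R C K) {γ : ℝ} (hγ : R < γ) :
    ∃ r₀ : ℝ, 0 < r₀ ∧ ∀ u z : ℝ, r₀ ≤ |u| → 2 * |z| ≤ |u| →
      s / 4 * |u| ≤ ‖secant ψ (tiltPoint ζ z) ((γ : ℂ) + Complex.I * (u : ℂ))‖ := by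
  have hC := B.one_le_C
  have hs := B.s_pos
  have hR := B.one_le_R
  have hζ := B.zeta_nonneg
  have hγ0 : 0 < γ := by linarith
  refine ⟨2 * (γ + ζ) + 16 * C / s, by positivity, fun u z hu hz => ?_⟩
  set l := (γ : ℂ) + Complex.I * (u : ℂ) with hl
  have h1 := B.secant_sub_le l (by simpa [hl] using hγ.le) z
  have h2 : |u| / 2 ≤ ‖l + tiltPoint ζ z‖ := by
    refine le_trans ?_ (Complex.abs_im_le_norm _)
    have : (l + tiltPoint ζ z).im = u - z := by simp [hl, im_tiltPoint, sub_eq_add_neg]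
    rw [this]
    have := abs_sub_abs_le_abs_sub u z
    linarith
  have h3 : ‖l‖ ≤ γ + |u| := by
    refine (norm_add_le _ _).trans ?_
    rw [norm_mul, Complex.norm_I, one_mul, Complex.norm_real, Complex.norm_real,
      Real.norm_eq_abs, Real.norm_eq_abs, abs_of_pos hγ0]
  have h4 : ‖tiltPoint ζ z‖ ≤ ζ + |u| / 2 := by
    refine (norm_sub_le _ _).trans ?_
    rw [norm_mul, Complex.norm_I, one_mul, norm_neg, Complex.norm_real, Complex.norm_real,
      Real.norm_eq_abs, Real.norm_eq_abs, abs_of_nonneg hζ]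
    linarith
  have h5 := norm_le_norm_add_norm_sub (secant ψ (tiltPoint ζ z) l) ((s : ℂ) * (l + tiltPoint ζ z))
  rw [norm_mul, Complex.norm_real, Real.norm_of_nonneg hs.le] at h5
  have h6 : s * (2 * (γ + ζ) + 16 * C / s) = 2 * s * (γ + ζ) + 16 * C := by field_simp
  have h7 := mul_le_mul_of_nonneg_left hu hs.le
  have h8 := mul_le_mul_of_nonneg_left h2 hs.le
  have h9 := mul_le_mul_of_nonneg_left (add_le_add h3 h4) (by positivity : 0 ≤ s / 8)
  nlinarith

/-- The square integrable weight `1 / √(1 + z²)`. -/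
lemma memLp_inv_sqrt_one_add_sq :
    MemLp (fun z : ℝ => (Real.sqrt (1 + z ^ 2))⁻¹) 2 volume := by
  rw [memLp_two_iff_integrable_sq (by
    refine Measurable.aestronglyMeasurable ?_
    fun_prop)]
  refine integrable_inv_one_add_sq.congr (Eventually.of_forall fun z => ?_)
  change (1 + z ^ 2)⁻¹ = ((Real.sqrt (1 + z ^ 2))⁻¹) ^ 2
  rw [inv_pow, Real.sq_sqrt (by positivity)]

/-- A square integrable majorant in `z`, of size `|l|`: for `|z|` large compared with `|l|` the secant
slope is of order `|z|`, and otherwise `1 + |z|` is of order `|l|`. -/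
lemma exists_norm_kernel_le (B : SecantBounds ψ ζ s R C K) :
    ∃ D : ℝ, 0 < D ∧ ∀ l : ℂ, R ≤ l.re → ∀ z : ℝ,
      ‖kernel ψ ζ l z‖ ≤ D * ‖l‖ * (Real.sqrt (1 + z ^ 2))⁻¹ := by
  have hC := B.one_le_C
  have hs := B.s_pos
  have hR := B.one_le_R
  refine ⟨C * (1 + (2 / s) * (1 + 2 * s + C)), by positivity, fun l hl z => ?_⟩
  have hl1 : 1 ≤ ‖l‖ := (hR.trans hl).trans (Complex.re_le_norm l)
  have hF1 := B.one_le_norm_secant hl z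
  have h1 := B.secant_sub_le l hl z
  set F := secant ψ (tiltPoint ζ z) l
  have hz : |z| ≤ ‖tiltPoint ζ z‖ := by
    have := Complex.abs_im_le_norm (tiltPoint ζ z)
    rwa [im_tiltPoint, abs_neg] at this
  have h2 : ‖tiltPoint ζ z‖ - ‖l‖ ≤ ‖l + tiltPoint ζ z‖ := by
    have := norm_sub_norm_le (tiltPoint ζ z) (-l)
    rwa [norm_neg, sub_neg_eq_add, add_comm (tiltPoint ζ z)] at this
  have h5 := norm_le_norm_add_norm_sub F ((s : ℂ) * (l + tiltPoint ζ z))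
  rw [norm_mul, Complex.norm_real, Real.norm_of_nonneg hs.le] at h5
  have h3 : s / 2 * |z| ≤ ‖F‖ + 2 * s * ‖l‖ + C := by
    have := mul_le_mul_of_nonneg_left h2 hs.le
    nlinarith [mul_nonneg hs.le (norm_nonneg l), mul_le_mul_of_nonneg_left hz hs.le,
      mul_nonneg hs.le (abs_nonneg z)]
  have h4 : ‖F‖ + 2 * s * ‖l‖ + C ≤ (1 + 2 * s + C) * (‖l‖ * ‖F‖) := by
    have e1 : ‖F‖ ≤ ‖l‖ * ‖F‖ := le_mul_of_one_le_left (norm_nonneg _) hl1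
    have e2 : ‖l‖ ≤ ‖l‖ * ‖F‖ := le_mul_of_one_le_right (norm_nonneg _) hF1
    have e3 : 1 ≤ ‖l‖ * ‖F‖ := hl1.trans e2
    nlinarith
  have h6 : |z| ≤ (2 / s) * (1 + 2 * s + C) * (‖l‖ * ‖F‖) := by
    calc |z| = 2 / s * (s / 2 * |z|) := by field_simp
      _ ≤ 2 / s * ((1 + 2 * s + C) * (‖l‖ * ‖F‖)) := by
        refine mul_le_mul_of_nonneg_left (h3.trans h4) (by positivity)
      _ = _ := by ring
  have h7 : Real.sqrt (1 + z ^ 2) ≤ (1 + (2 / s) * (1 + 2 * s + C)) * (‖l‖ * ‖F‖) := by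
    have e3 : 1 ≤ ‖l‖ * ‖F‖ := one_le_mul_of_one_le_of_one_le hl1 hF1
    have e4 : Real.sqrt (1 + z ^ 2) ≤ 1 + |z| := by
      rw [Real.sqrt_le_left (by positivity)]
      nlinarith [sq_abs z, abs_nonneg z]
    linarith
  refine (B.norm_kernel_le_div hl z).trans ?_
  rw [div_le_iff₀ (by linarith), ← div_eq_mul_inv, div_mul_eq_mul_div,
    le_div_iff₀ (by positivity)]
  calc C * Real.sqrt (1 + z ^ 2) ≤ C * ((1 + (2 / s) * (1 + 2 * s + C)) * (‖l‖ * ‖F‖)) := by gcongr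
    _ = _ := by ring

lemma continuous_kernel_right (B : SecantBounds ψ ζ s R C K) {v : ℝ} (hv : R ≤ v) (u : ℝ) :
    Continuous fun z : ℝ => kernel ψ ζ ((v : ℂ) + Complex.I * (u : ℂ)) z := by
  have h := (B.continuous_kernel hv).comp (Continuous.prodMk_right u)
  simpa only [Function.comp_def] using h

theorem isAdmissibleAbscissa (B : SecantBounds ψ ζ s R C K) : IsAdmissibleAbscissa ψ ζ R := by
  have hC := B.one_le_C
  obtain ⟨w, hw, D, hD, hk⟩ : ∃ w : ℝ → ℝ, MemLp w 2 volume ∧ ∃ D : ℝ, 0 < D ∧ ∀ l : ℂ,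
      R ≤ l.re → ∀ z : ℝ, ‖kernel ψ ζ l z‖ ≤ D * ‖l‖ * w z :=
    ⟨_, memLp_inv_sqrt_one_add_sq, B.exists_norm_kernel_le⟩
  obtain ⟨A, hA⟩ : ∃ A, A = (eLpNorm w 2 volume).toReal := ⟨_, rfl⟩
  have hA0 : 0 ≤ A := hA ▸ ENNReal.toReal_nonneg
  refine ⟨by linarith [B.one_le_R], C + D * A, by positivity, fun v hv u => ?_⟩
  have hre : R ≤ ((v : ℂ) + Complex.I * (u : ℂ)).re := by simpa using hv
  have hkc : Continuous fun z => kernel ψ ζ ((v : ℂ) + Complex.I * (u : ℂ)) z :=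
    B.continuous_kernel_right hv u
  generalize (v : ℂ) + Complex.I * (u : ℂ) = l at hre hkc ⊢
  have hl1 : 1 ≤ ‖l‖ := (B.one_le_R.trans hre).trans (Complex.re_le_norm l)
  refine ⟨fun z h => B.exponent_sub_ne_zero hre z (sub_eq_zero.mpr h), fun f hf => ?_⟩
  have hf' : AEStronglyMeasurable f volume := hf.elim (·.1) (·.1)
  rw [mul_min_of_nonneg]
  swap
  · exact zero_le
  refine le_min ?_ ?_
  · calc ∫⁻ z : ℝ, ‖kernel ψ ζ l z‖ₑ * ‖f z‖ₑ
        ≤ ∫⁻ z : ℝ, ENNReal.ofReal ((C + D * A) * ‖l‖) * ‖f z‖ₑ := by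
          refine lintegral_mono fun z => mul_le_mul_left ?_ _
          rw [← ofReal_norm]
          refine ENNReal.ofReal_le_ofReal ((B.norm_kernel_le hre z).trans ?_)
          have : 0 ≤ D * A := by positivity
          nlinarith
      _ = _ := by
          rw [lintegral_const_mul' _ _ ENNReal.ofReal_ne_top, eLpNorm_one_eq_lintegral_enorm]
  · have h1 : ∫⁻ z : ℝ, ‖kernel ψ ζ l z‖ₑ * ‖f z‖ₑ
        ≤ eLpNorm (fun z => kernel ψ ζ l z) 2 volume * eLpNorm f 2 volume := by
      have h := eLpNorm_smul_le_mul_eLpNorm (p := 2) (q := 2) (r := 1) hf'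
        hkc.aestronglyMeasurable (μ := volume)
      rw [eLpNorm_one_eq_lintegral_enorm] at h
      refine le_trans (le_of_eq ?_) h
      refine lintegral_congr fun z => ?_
      rw [Pi.smul_apply', smul_eq_mul, enorm_mul]
    refine h1.trans (mul_le_mul_left ?_ _)
    have h2 : eLpNorm (fun z => kernel ψ ζ l z) 2 volume
        ≤ eLpNorm ((D * ‖l‖) • w) 2 volume :=
      eLpNorm_mono_real fun z => hk l hre z
    refine h2.trans ?_
    rw [eLpNorm_const_smul, Real.enorm_of_nonneg (by positivity),
      ← ENNReal.ofReal_toReal hw.eLpNorm_ne_top, ← hA, ← ENNReal.ofReal_mul (by positivity)]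
    refine ENNReal.ofReal_le_ofReal ?_
    have : 0 ≤ C * ‖l‖ := by positivity
    linarith

end SecantBounds

/-! ### Oscillatory integrals along a vertical line -/

lemma norm_exp_vertical (γ u x : ℝ) :
    ‖Complex.exp (((γ : ℂ) + Complex.I * (u : ℂ)) * (x : ℂ))‖ = Real.exp (γ * x) := by
  rw [Complex.norm_exp, Complex.re_mul_ofReal]
  simp

lemma hasDerivAt_exp_vertical (γ u x : ℝ) :
    HasDerivAt (fun u : ℝ => Complex.exp (((γ : ℂ) + Complex.I * (u : ℂ)) * (x : ℂ)))
      (Complex.I * x * Complex.exp (((γ : ℂ) + Complex.I * (u : ℂ)) * (x : ℂ))) u := by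
  have h1 : HasDerivAt (fun u : ℝ => ((γ : ℂ) + Complex.I * (u : ℂ)) * (x : ℂ))
      (Complex.I * x) u := by
    simpa using (((Complex.ofRealCLM.hasDerivAt (x := u)).const_mul
      Complex.I).const_add (γ : ℂ)).mul_const (x : ℂ)
  exact h1.cexp.congr_deriv (mul_comm _ _)

/-- Integration by parts in `u`: an oscillatory integral gains the factor `1 / x` against an
amplitude whose derivative is dominated by the derivative of `Φ`. -/
lemma norm_integral_exp_vertical_mul_le {γ x a b : ℝ} (hx : 0 < x) (hab : a ≤ b) {k k' : ℝ → ℂ}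
    {Φ Φ' : ℝ → ℝ} (hkc : Continuous k) (hk : ∀ u ∈ Icc a b, HasDerivAt k (k' u) u)
    (hΦ : ∀ u ∈ Icc a b, HasDerivAt Φ (Φ' u) u) (hle : ∀ u ∈ Icc a b, ‖k' u‖ ≤ Φ' u) :
    ‖∫ u in a..b, Complex.exp (((γ : ℂ) + Complex.I * (u : ℂ)) * (x : ℂ)) * k u‖
      ≤ Real.exp (γ * x) / x * (‖k a‖ + ‖k b‖ + (Φ b - Φ a)) := by
  set E : ℝ → ℂ := fun u => Complex.exp (((γ : ℂ) + Complex.I * (u : ℂ)) * (x : ℂ)) with hE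
  have hEc : Continuous E := by fun_prop
  have hEn : ∀ u, ‖E u‖ = Real.exp (γ * x) := fun u => norm_exp_vertical γ u x
  have hx0 : (x : ℂ) ≠ 0 := by exact_mod_cast hx.ne'
  set G : ℝ → ℂ := fun t => (∫ u in a..t, E u * k u) - E t * k t / (Complex.I * x)
  have hG : ∀ t ∈ Icc a b, HasDerivAt (fun t => G t - G a) (-(E t * k' t / (Complex.I * x))) t := by
    intro t ht
    have h1 : HasDerivAt (fun t => ∫ u in a..t, E u * k u) (E t * k t) t :=
      intervalIntegral.integral_hasDerivAt_right ((hEc.mul hkc).intervalIntegrable _ _)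
        ((hEc.mul hkc).stronglyMeasurableAtFilter _ _) (hEc.mul hkc).continuousAt
    have h2 := (((hasDerivAt_exp_vertical γ t x).mul (hk t ht)).div_const (Complex.I * x))
    refine ((h1.sub h2).sub_const (G a)).congr_deriv ?_
    change E t * k t - (Complex.I * x * E t * k t + E t * k' t) / (Complex.I * x) = _
    field_simp
    ring
  have hbound := image_norm_le_of_norm_deriv_right_le_deriv_boundary'
    (f := fun t => G t - G a) (f' := fun t => -(E t * k' t / (Complex.I * x))) (a := a) (b := b)
    (B := fun t => Real.exp (γ * x) / x * (Φ t - Φ a))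
    (B' := fun t => Real.exp (γ * x) / x * Φ' t)
    (fun t ht => (hG t ht).continuousAt.continuousWithinAt)
    (fun t ht => (hG t (Ico_subset_Icc_self ht)).hasDerivWithinAt) (by simp)
    (fun t ht => (((hΦ t ht).sub_const _).const_mul _).continuousAt.continuousWithinAt)
    (fun t ht => (((hΦ t (Ico_subset_Icc_self ht)).sub_const _).const_mul _).hasDerivWithinAt)
    (fun t ht => by
      rw [norm_neg, norm_div, norm_mul, hEn, norm_mul, Complex.norm_I, one_mul, Complex.norm_real,
        Real.norm_of_nonneg hx.le, mul_div_right_comm]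
      exact mul_le_mul_of_nonneg_left (hle t (Ico_subset_Icc_self ht)) (by positivity))
    (right_mem_Icc.mpr hab)
  have hsplit : ∫ u in a..b, E u * k u
      = (G b - G a) + E b * k b / (Complex.I * x) - E a * k a / (Complex.I * x) := by
    simp only [G, intervalIntegral.integral_same]
    ring
  have hn : ∀ t, ‖E t * k t / (Complex.I * x)‖ = Real.exp (γ * x) / x * ‖k t‖ := fun t => by
    rw [norm_div, norm_mul, hEn, norm_mul, Complex.norm_I, one_mul, Complex.norm_real,
      Real.norm_of_nonneg hx.le, mul_div_right_comm]
  rw [hsplit]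
  refine (norm_sub_le _ _).trans ((add_le_add (norm_add_le _ _) le_rfl).trans ?_)
  rw [hn, hn]
  refine (add_le_add (add_le_add hbound le_rfl) le_rfl).trans (le_of_eq ?_)
  ring

/-- What the inversion along the line `Re = γ` uses about the kernel `K(u, z)`: it is continuous,
bounded and Hermitian, and its oscillatory integrals in `u` are bounded, with a gain of `1 / r` on
`r ≤ |u|` when `2 |z| ≤ r`. -/
structure OscillatoryKernel (K : ℝ → ℝ → ℂ) (γ C r₀ : ℝ) : Prop where
  gamma_pos : 0 < γ
  C_pos : 0 < C
  r₀_pos : 0 < r₀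
  continuous : Continuous fun q : ℝ × ℝ => K q.1 q.2
  norm_le : ∀ u z, ‖K u z‖ ≤ C
  neg_neg : ∀ u z, K (-u) (-z) = (starRingEnd ℂ) (K u z)
  osc : ∀ z a b x : ℝ, a ≤ b → 0 < x →
    ‖∫ u in a..b, Complex.exp (((γ : ℂ) + Complex.I * (u : ℂ)) * (x : ℂ)) * K u z‖
      ≤ C * (Real.exp (γ * x) / x)
  osc_right : ∀ z r r' x : ℝ, r₀ ≤ r → r ≤ r' → 0 < x → 2 * |z| ≤ r →
    ‖∫ u in r..r', Complex.exp (((γ : ℂ) + Complex.I * (u : ℂ)) * (x : ℂ)) * K u z‖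
      ≤ C * (Real.exp (γ * x) / x) / r
  osc_left : ∀ z r r' x : ℝ, r₀ ≤ r → r ≤ r' → 0 < x → 2 * |z| ≤ r →
    ‖∫ u in (-r')..(-r), Complex.exp (((γ : ℂ) + Complex.I * (u : ℂ)) * (x : ℂ)) * K u z‖
      ≤ C * (Real.exp (γ * x) / x) / r

theorem SecantBounds.exists_oscillatoryKernel {ψ : ℂ → ℂ} {ζ s R C K : ℝ}
    (B : SecantBounds ψ ζ s R C K) {γ : ℝ} (hγ : R < γ) :
    ∃ A r₀ : ℝ, OscillatoryKernel
      (fun u z => kernel ψ ζ ((γ : ℂ) + Complex.I * (u : ℂ)) z) γ A r₀ := by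
  obtain ⟨D, hD, hvar⟩ := B.exists_variation_bound
  obtain ⟨r₀, hr₀, hF⟩ := B.exists_le_norm_secant hγ
  have hC := B.one_le_C
  have hs := B.s_pos
  have hR := B.one_le_R
  have hcont := B.continuous_kernel hγ.le
  have hre : ∀ u : ℝ, R < ((γ : ℂ) + Complex.I * (u : ℂ)).re := fun u => by simpa using hγ
  have hcu : ∀ z, Continuous fun u : ℝ => kernel ψ ζ ((γ : ℂ) + Complex.I * (u : ℂ)) z := fun z => by
    have h := hcont.comp (Continuous.prodMk_left z)
    simpa only [Function.comp_def] using h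
  set A₁ := 4 * C ^ 2 * (4 + 16 / s ^ 2) with hA₁
  set A₂ := 4 * C / s with hA₂
  have hA₁0 : 0 < A₁ := by positivity
  have hA₂0 : 0 < A₂ := by positivity
  have hsize : ∀ u z : ℝ, r₀ ≤ |u| → 2 * |z| ≤ |u| →
      ‖kernel ψ ζ ((γ : ℂ) + Complex.I * (u : ℂ)) z‖ ≤ A₂ / |u| := fun u z hu hz => by
    have hu0 : 0 < |u| := hr₀.trans_le hu
    refine (B.norm_kernel_le_div (hre u).le z).trans ?_
    calc C / ‖secant ψ (tiltPoint ζ z) ((γ : ℂ) + Complex.I * (u : ℂ))‖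
        ≤ C / (s / 4 * |u|) :=
          div_le_div_of_nonneg_left (by linarith) (by positivity) (hF u z hu hz)
      _ = A₂ / |u| := by rw [hA₂]; field_simp
  have hslope : ∀ u z : ℝ, r₀ ≤ |u| → 2 * |z| ≤ |u| → ∀ k' : ℂ,
      HasDerivAt (fun u : ℝ => kernel ψ ζ ((γ : ℂ) + Complex.I * (u : ℂ)) z) k' u →
      ‖k'‖ ≤ A₁ / u ^ 2 := fun u z hu hz k' hk' => by
    have hu0 : 0 < |u| := hr₀.trans_le hu
    have hu2 : 0 < u ^ 2 := by rw [← sq_abs]; positivity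
    obtain ⟨k₁, hk₁, hle⟩ := B.exists_hasDerivAt_kernel (hre u) z
    have hline : HasDerivAt (fun u : ℝ => (γ : ℂ) + Complex.I * (u : ℂ)) Complex.I u := by
      simpa using ((Complex.ofRealCLM.hasDerivAt (x := u)).const_mul Complex.I).const_add (γ : ℂ)
    have h1 := HasDerivAt.comp (h₂ := fun y => kernel ψ ζ y z) u hk₁ hline
    have h2 : k' = k₁ * Complex.I := hk'.unique h1
    rw [h2, norm_mul, Complex.norm_I, mul_one]
    refine hle.trans ?_
    have hW : |u| / 2 ≤ ‖(γ : ℂ) + Complex.I * (u : ℂ) - tiltPoint ζ z‖ := by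
      refine le_trans ?_ (Complex.abs_im_le_norm _)
      have e : ((γ : ℂ) + Complex.I * (u : ℂ) - tiltPoint ζ z).im = u - -z := by
        simp [im_tiltPoint]
      rw [e]
      have := abs_sub_abs_le_abs_sub u (-z)
      rw [abs_neg] at this
      linarith
    have e1 : 1 / ‖(γ : ℂ) + Complex.I * (u : ℂ) - tiltPoint ζ z‖ ^ 2 ≤ 4 / u ^ 2 := by
      calc _ ≤ 1 / (|u| / 2) ^ 2 :=
            one_div_le_one_div_of_le (by positivity) (pow_le_pow_left₀ (by positivity) hW 2)
        _ = 4 / u ^ 2 := by rw [div_pow, sq_abs]; field_simp; norm_num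
    have e2 : 1 / ‖secant ψ (tiltPoint ζ z) ((γ : ℂ) + Complex.I * (u : ℂ))‖ ^ 2
        ≤ 16 / s ^ 2 / u ^ 2 := by
      calc _ ≤ 1 / (s / 4 * |u|) ^ 2 := one_div_le_one_div_of_le (by positivity)
            (pow_le_pow_left₀ (by positivity) (hF u z hu hz) 2)
        _ = 16 / s ^ 2 / u ^ 2 := by rw [mul_pow, sq_abs]; field_simp; norm_num
    calc _ ≤ 4 * C ^ 2 * (4 / u ^ 2 + 16 / s ^ 2 / u ^ 2) := by gcongr
      _ = A₁ / u ^ 2 := by rw [hA₁]; ring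
  -- both tails are integrations by parts against the primitive `-A₁ / u` of `A₁ / u²`
  have htail : ∀ z a b r x : ℝ, r₀ ≤ r → 0 < x → 2 * |z| ≤ r → a ≤ b →
      (∀ u ∈ Icc a b, r ≤ |u|) → A₁ / a - A₁ / b ≤ A₁ / r →
      ‖∫ u in a..b, Complex.exp (((γ : ℂ) + Complex.I * (u : ℂ)) * (x : ℂ))
        * kernel ψ ζ ((γ : ℂ) + Complex.I * (u : ℂ)) z‖
        ≤ (2 * A₂ + A₁) * (Real.exp (γ * x) / x) / r := fun z a b r x hr hx hz hab hu hΦ => by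
    have hr0 : 0 < r := hr₀.trans_le hr
    have hne : ∀ u ∈ Icc a b, u ≠ 0 := fun u h => abs_pos.mp (hr0.trans_le (hu u h))
    obtain ⟨_, _, _, _, hk⟩ := hvar γ hγ z
    choose k' hk' using hk
    have hsz : ∀ u ∈ Icc a b, ‖kernel ψ ζ ((γ : ℂ) + Complex.I * (u : ℂ)) z‖ ≤ A₂ / r := fun u h =>
      (hsize u z (hr.trans (hu u h)) (hz.trans (hu u h))).trans
        (div_le_div_of_nonneg_left hA₂0.le hr0 (hu u h))
    refine (norm_integral_exp_vertical_mul_le (γ := γ) hx hab (hcu z) (k' := k')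
      (Φ := fun u => -A₁ * u⁻¹) (Φ' := fun u => A₁ / u ^ 2) (fun u _ => (hk' u).1)
      (fun u h => ((hasDerivAt_inv (hne u h)).const_mul (-A₁)).congr_deriv (by
        rw [neg_mul_neg, div_eq_mul_inv]))
      (fun u h => hslope u z (hr.trans (hu u h)) (hz.trans (hu u h)) _ (hk' u).1)).trans ?_
    have h1 := hsz a (left_mem_Icc.mpr hab)
    have h2 := hsz b (right_mem_Icc.mpr hab)
    have h3 : -A₁ * b⁻¹ - -A₁ * a⁻¹ = A₁ / a - A₁ / b := by ring
    calc _ ≤ Real.exp (γ * x) / x * (A₂ / r + A₂ / r + A₁ / r) := by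
          refine mul_le_mul_of_nonneg_left ?_ (by positivity)
          linarith
      _ = _ := by ring
  refine ⟨2 * C + 2 * D + 2 * A₂ + A₁, r₀, by linarith, by positivity, hr₀, hcont, ?_, ?_, ?_,
    ?_, ?_⟩
  · intro u z
    have := B.norm_kernel_le (hre u).le z
    linarith
  · exact fun u z => B.kernel_neg_neg hγ.le u z
  · intro z a b x hab hx
    obtain ⟨Φ, Φ', hΦ, hΦD, hk⟩ := hvar γ hγ z
    choose k' hk' using hk
    refine (norm_integral_exp_vertical_mul_le (γ := γ) hx hab (hcu z) (fun u _ => (hk' u).1)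
      (fun u _ => hΦ u) (fun u _ => (hk' u).2)).trans ?_
    rw [mul_comm]
    refine mul_le_mul_of_nonneg_right ?_ (by positivity)
    have h1 := B.norm_kernel_le (hre a).le z
    have h2 := B.norm_kernel_le (hre b).le z
    have h3 := (abs_le.mp (hΦD a)).1
    have h4 := (abs_le.mp (hΦD b)).2
    linarith
  all_goals
    intro z r r' x hr hrr' hx hz
    have hr0 : 0 < r := hr₀.trans_le hr
    have h0 : 0 < A₁ / r' := div_pos hA₁0 (hr0.trans_le hrr')
  · refine (htail z r r' r x hr hx hz hrr' (fun u hu => hu.1.trans (le_abs_self u))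
      (by linarith)).trans ?_
    gcongr
    linarith
  · refine (htail z (-r') (-r) r x hr hx hz (neg_le_neg hrr')
      (fun u hu => (le_neg.mp hu.2).trans (neg_le_abs u)) ?_).trans ?_
    · rw [div_neg, div_neg]; linarith
    · gcongr
      linarith

/-! ### Inversion along a vertical line -/

/-- The truncated inversion `(1 / 2π) ∫_{-r}^r e^{(γ + i u) x} H(u) du`. -/
noncomputable def truncInversion (γ : ℝ) (H : ℝ → ℂ) (r x : ℝ) : ℂ :=
  (1 / (2 * (Real.pi : ℂ))) * ∫ u in (-r)..r,
    Complex.exp (((γ : ℂ) + Complex.I * (u : ℂ)) * (x : ℂ)) * H u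

lemma norm_one_div_two_pi_mul_le (w : ℂ) : ‖(1 / (2 * (Real.pi : ℂ))) * w‖ ≤ ‖w‖ / 2 := by
  rw [norm_mul, norm_div, norm_one, norm_mul, Complex.norm_ofNat, Complex.norm_real,
    Real.norm_of_nonneg Real.pi_pos.le, one_div_mul_eq_div]
  have := Real.pi_gt_three
  exact div_le_div_of_nonneg_left (norm_nonneg _) (by norm_num) (by linarith)

lemma continuous_truncInversion (γ : ℝ) {H : ℝ → ℂ} (hH : Continuous H) (r : ℝ) :
    Continuous fun x => truncInversion γ H r x := by
  refine continuous_const.mul ?_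
  exact intervalIntegral.continuous_parametric_intervalIntegral_of_continuous' (by fun_prop) _ _

/-- A Hermitian amplitude has a real truncated inversion. -/
lemma conj_truncInversion (γ : ℝ) {H : ℝ → ℂ} (hH : ∀ u, H (-u) = (starRingEnd ℂ) (H u)) (r x : ℝ) :
    (starRingEnd ℂ) (truncInversion γ H r x) = truncInversion γ H r x := by
  have h1 : (starRingEnd ℂ) (∫ u in (-r)..r,
      Complex.exp (((γ : ℂ) + Complex.I * (u : ℂ)) * (x : ℂ)) * H u)
      = ∫ u in (-r)..r, Complex.exp (((γ : ℂ) + Complex.I * ((-u : ℝ) : ℂ)) * (x : ℂ)) * H (-u) := by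
    rw [intervalIntegral.intervalIntegral_eq_integral_uIoc,
      intervalIntegral.intervalIntegral_eq_integral_uIoc, Complex.real_smul, map_mul,
      Complex.conj_ofReal, ← integral_conj, Complex.real_smul]
    congr 2
    funext u
    rw [map_mul, ← Complex.exp_conj, hH]
    simp
  have h2 := intervalIntegral.integral_comp_neg (a := -r) (b := r)
    fun u : ℝ => Complex.exp (((γ : ℂ) + Complex.I * (u : ℂ)) * (x : ℂ)) * H u
  rw [neg_neg] at h2
  rw [truncInversion, map_mul, h1, h2]
  simp [Complex.conj_ofNat]

lemma tendsto_setIntegral_tail {f : ℝ → ℝ} (hf : Integrable f) :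
    Tendsto (fun r : ℝ => ∫ z in {z : ℝ | r / 2 < |z|}, f z) atTop (𝓝 0) := by
  have h := tendsto_setIntegral_of_antitone (μ := volume) (f := f)
    (s := fun r : ℝ => {z : ℝ | r / 2 < |z|})
    (fun r => measurableSet_lt measurable_const measurable_norm)
    (fun r r' h z (hz : r' / 2 < |z|) => show r / 2 < |z| by linarith) ⟨0, hf.integrableOn⟩
  have hempty : (⋂ r : ℝ, {z : ℝ | r / 2 < |z|}) = ∅ := by
    ext z
    simp only [mem_iInter, mem_ofPred_eq, mem_empty_iff_false, iff_false, not_forall, not_lt]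
    exact ⟨2 * |z|, by linarith⟩
  rwa [hempty, Measure.restrict_empty, integral_zero_measure] at h

namespace OscillatoryKernel

variable {K : ℝ → ℝ → ℂ} {γ C r₀ : ℝ} {f : ℝ → ℂ}

lemma continuous_left (hK : OscillatoryKernel K γ C r₀) (z : ℝ) : Continuous fun u => K u z := by
  have h := hK.continuous.comp (Continuous.prodMk_left z)
  simpa only [Function.comp_def] using h

lemma continuous_right (hK : OscillatoryKernel K γ C r₀) (u : ℝ) : Continuous fun z => K u z := by
  have h := hK.continuous.comp (Continuous.prodMk_right u)
  simpa only [Function.comp_def] using h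

lemma integrable_mul (hK : OscillatoryKernel K γ C r₀) (hf : Integrable f) (u : ℝ) :
    Integrable fun z => K u z * f z :=
  hf.bdd_mul (hK.continuous_right u).aestronglyMeasurable
    (Eventually.of_forall fun z => hK.norm_le u z)

lemma continuous_integral (hK : OscillatoryKernel K γ C r₀) (hf : Integrable f) :
    Continuous fun u => ∫ z, K u z * f z := by
  refine continuous_of_dominated (bound := fun z => C * ‖f z‖)
    (fun u => (hK.integrable_mul hf u).aestronglyMeasurable) (fun u => ?_) (hf.norm.const_mul C)
    (Eventually.of_forall fun z => (hK.continuous_left z).mul continuous_const)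
  refine Eventually.of_forall fun z => ?_
  rw [norm_mul]
  exact mul_le_mul_of_nonneg_right (hK.norm_le u z) (norm_nonneg _)

lemma norm_integral_le (hK : OscillatoryKernel K γ C r₀) (hf : Integrable f) (u : ℝ) :
    ‖∫ z, K u z * f z‖ ≤ C * ∫ z, ‖f z‖ := by
  rw [← integral_const_mul]
  refine norm_integral_le_of_norm_le (hf.norm.const_mul C) (Eventually.of_forall fun z => ?_)
  rw [norm_mul]
  exact mul_le_mul_of_nonneg_right (hK.norm_le u z) (norm_nonneg _)

/-- Interchanging the integrals in `u` and `z` turns a bound `M₁` on the oscillatory integrals of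
the kernel, weakened to `M₂` for `z ∈ S`, into a bound for the integral against `f`. -/
lemma norm_integral_exp_mul_le (hK : OscillatoryKernel K γ C r₀) (hf : Integrable f) {a b x : ℝ}
    {M₁ M₂ : ℝ} (hM₁ : 0 ≤ M₁) {S : Set ℝ} (hS : MeasurableSet S)
    (h₁ : ∀ z ∉ S,
      ‖∫ u in a..b, Complex.exp (((γ : ℂ) + Complex.I * (u : ℂ)) * (x : ℂ)) * K u z‖ ≤ M₁)
    (h₂ : ∀ z ∈ S,
      ‖∫ u in a..b, Complex.exp (((γ : ℂ) + Complex.I * (u : ℂ)) * (x : ℂ)) * K u z‖ ≤ M₂) :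
    ‖∫ u in a..b, Complex.exp (((γ : ℂ) + Complex.I * (u : ℂ)) * (x : ℂ)) * ∫ z, K u z * f z‖
      ≤ M₁ * (∫ z, ‖f z‖) + M₂ * ∫ z in S, ‖f z‖ := by
  have hint : Integrable (Function.uncurry fun (u z : ℝ) =>
      Complex.exp (((γ : ℂ) + Complex.I * (u : ℂ)) * (x : ℂ)) * K u z * f z)
      ((volume.restrict (uIoc a b)).prod volume) := by
    have hone : Integrable (fun _ : ℝ => (1 : ℂ)) (volume.restrict (uIoc a b)) :=
      integrable_const_iff.mpr (Or.inr ⟨by simp [uIoc, Measure.restrict_apply]⟩)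
    have h := (hone.mul_prod hf).bdd_mul (c := Real.exp (γ * x) * C)
      (f := fun q : ℝ × ℝ => Complex.exp (((γ : ℂ) + Complex.I * (q.1 : ℂ)) * (x : ℂ)) * K q.1 q.2)
      (Continuous.aestronglyMeasurable (Continuous.mul (by fun_prop) hK.continuous))
      (Eventually.of_forall fun q => by
        rw [norm_mul, norm_exp_vertical]
        exact mul_le_mul_of_nonneg_left (hK.norm_le _ _) (Real.exp_pos _).le)
    simpa only [Function.uncurry_def, one_mul] using h
  have hswap := intervalIntegral_integral_swap hint
  have e1 : ∀ u : ℝ, ∫ z, Complex.exp (((γ : ℂ) + Complex.I * (u : ℂ)) * (x : ℂ)) * K u z * f z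
      = Complex.exp (((γ : ℂ) + Complex.I * (u : ℂ)) * (x : ℂ)) * ∫ z, K u z * f z := fun u => by
    rw [← integral_const_mul]
    exact integral_congr_ae (Eventually.of_forall fun z => mul_assoc _ _ _)
  simp only [e1, intervalIntegral.integral_mul_const] at hswap
  rw [hswap]
  have hbd : Integrable fun z => M₁ * ‖f z‖ + S.indicator (fun z => M₂ * ‖f z‖) z :=
    (hf.norm.const_mul M₁).add ((hf.norm.const_mul M₂).indicator hS)
  refine (norm_integral_le_of_norm_le hbd (Eventually.of_forall fun z => ?_)).trans (le_of_eq ?_)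
  · rw [norm_mul]
    by_cases hz : z ∈ S
    · rw [indicator_of_mem hz]
      have := mul_le_mul_of_nonneg_right (h₂ z hz) (norm_nonneg (f z))
      have h3 : 0 ≤ M₁ * ‖f z‖ := by positivity
      linarith
    · rw [indicator_of_notMem hz, add_zero]
      exact mul_le_mul_of_nonneg_right (h₁ z hz) (norm_nonneg (f z))
  · rw [integral_add (hf.norm.const_mul M₁) ((hf.norm.const_mul M₂).indicator hS),
      integral_indicator hS, integral_const_mul, integral_const_mul]

lemma norm_truncInversion_le (hK : OscillatoryKernel K γ C r₀) (hf : Integrable f) {r x : ℝ}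
    (hr : 0 ≤ r) (hx : 0 < x) :
    ‖truncInversion γ (fun u => ∫ z, K u z * f z) r x‖
      ≤ C * (Real.exp (γ * x) / x) * ∫ z, ‖f z‖ := by
  have h0 : 0 ≤ C * (Real.exp (γ * x) / x) := by have := hK.C_pos; positivity
  have h := hK.norm_integral_exp_mul_le hf (a := -r) (b := r) (x := x) h0 MeasurableSet.empty
    (fun z _ => hK.osc z _ _ x (by linarith) hx) (M₂ := 0) (fun z hz => absurd hz (notMem_empty z))
  rw [zero_mul, add_zero] at h
  refine (norm_one_div_two_pi_mul_le _).trans ?_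
  have h2 : 0 ≤ ∫ z, ‖f z‖ := integral_nonneg fun z => norm_nonneg _
  have := mul_nonneg h0 h2
  linarith

lemma norm_truncInversion_sub_le (hK : OscillatoryKernel K γ C r₀) (hf : Integrable f) {r r' x : ℝ}
    (hr : r₀ ≤ r) (hrr' : r ≤ r') (hx : 0 < x) :
    ‖truncInversion γ (fun u => ∫ z, K u z * f z) r' x
        - truncInversion γ (fun u => ∫ z, K u z * f z) r x‖
      ≤ C * (Real.exp (γ * x) / x)
        * ((∫ z, ‖f z‖) / r + ∫ z in {z : ℝ | r / 2 < |z|}, ‖f z‖) := by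
  have h0 : 0 ≤ C * (Real.exp (γ * x) / x) := by have := hK.C_pos; positivity
  have hr0 : 0 < r := hK.r₀_pos.trans_le hr
  have hS : MeasurableSet {z : ℝ | r / 2 < |z|} :=
    measurableSet_lt measurable_const measurable_norm
  have hz : ∀ z : ℝ, z ∉ {z : ℝ | r / 2 < |z|} → 2 * |z| ≤ r := fun z hz => by
    have : |z| ≤ r / 2 := not_lt.mp hz
    linarith
  have hR := hK.norm_integral_exp_mul_le hf (a := r) (b := r') (x := x) (div_nonneg h0 hr0.le) hS
    (fun z h => hK.osc_right z r r' x hr hrr' hx (hz z h))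
    (fun z _ => hK.osc z _ _ x hrr' hx)
  have hL := hK.norm_integral_exp_mul_le hf (a := -r') (b := -r) (x := x) (div_nonneg h0 hr0.le) hS
    (fun z h => hK.osc_left z r r' x hr hrr' hx (hz z h))
    (fun z _ => hK.osc z _ _ x (neg_le_neg hrr') hx)
  have hcont : Continuous fun u : ℝ =>
      Complex.exp (((γ : ℂ) + Complex.I * (u : ℂ)) * (x : ℂ)) * ∫ z, K u z * f z :=
    Continuous.mul (by fun_prop) (hK.continuous_integral hf)
  have hi := fun a b : ℝ => hcont.intervalIntegrable (μ := volume) a b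
  have hsplit : truncInversion γ (fun u => ∫ z, K u z * f z) r' x
        - truncInversion γ (fun u => ∫ z, K u z * f z) r x
      = (1 / (2 * (Real.pi : ℂ))) * ((∫ u in (-r')..(-r),
          Complex.exp (((γ : ℂ) + Complex.I * (u : ℂ)) * (x : ℂ)) * ∫ z, K u z * f z)
        + ∫ u in r..r',
          Complex.exp (((γ : ℂ) + Complex.I * (u : ℂ)) * (x : ℂ)) * ∫ z, K u z * f z) := by
    rw [truncInversion, truncInversion, ← mul_sub,
      ← intervalIntegral.integral_add_adjacent_intervals (hi (-r') (-r)) (hi (-r) r'),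
      ← intervalIntegral.integral_add_adjacent_intervals (hi (-r) r) (hi r r')]
    ring
  rw [hsplit]
  refine (norm_one_div_two_pi_mul_le _).trans ?_
  have := norm_add_le (∫ u in (-r')..(-r),
      Complex.exp (((γ : ℂ) + Complex.I * (u : ℂ)) * (x : ℂ)) * ∫ z, K u z * f z)
    (∫ u in r..r', Complex.exp (((γ : ℂ) + Complex.I * (u : ℂ)) * (x : ℂ)) * ∫ z, K u z * f z)
  rw [mul_add, ← mul_div_assoc, ← div_mul_eq_mul_div]
  linarith

/-- The truncated inversions converge at every `x > 0`, at a rate that is locally uniform. -/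
lemma exists_limit (hK : OscillatoryKernel K γ C r₀) (hf : Integrable f) :
    ∃ L : ℝ → ℂ, (∀ x, 0 < x →
      Tendsto (fun r => truncInversion γ (fun u => ∫ z, K u z * f z) r x) atTop (𝓝 (L x))) ∧
      ∀ x, 0 < x → ∀ r, r₀ ≤ r →
        ‖L x - truncInversion γ (fun u => ∫ z, K u z * f z) r x‖
          ≤ C * (Real.exp (γ * x) / x)
            * ((∫ z, ‖f z‖) / r + ∫ z in {z : ℝ | r / 2 < |z|}, ‖f z‖) := by
  have htail : Tendsto (fun r : ℝ => (∫ z, ‖f z‖) / r + ∫ z in {z : ℝ | r / 2 < |z|}, ‖f z‖)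
      atTop (𝓝 0) := by
    simpa using (tendsto_id.const_div_atTop (∫ z, ‖f z‖)).add (tendsto_setIntegral_tail hf.norm)
  have hlim : ∀ x : ℝ, 0 < x → ∃ l : ℂ,
      Tendsto (fun r => truncInversion γ (fun u => ∫ z, K u z * f z) r x) atTop (𝓝 l) := by
    intro x hx
    refine cauchySeq_tendsto_of_complete (Metric.cauchySeq_iff'.mpr fun ε hε => ?_)
    have h1 := htail.const_mul (C * (Real.exp (γ * x) / x))
    rw [mul_zero] at h1
    obtain ⟨N, hN1, hN2⟩ := ((h1.eventually_lt_const hε).and (eventually_ge_atTop r₀)).exists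
    refine ⟨N, fun r hr => ?_⟩
    rw [dist_eq_norm]
    exact (hK.norm_truncInversion_sub_le hf hN2 hr hx).trans_lt hN1
  choose! L hL using hlim
  refine ⟨L, hL, fun x hx r hr => ?_⟩
  refine le_of_tendsto ((hL x hx).sub_const _).norm ?_
  filter_upwards [eventually_ge_atTop r] with r' hr'
  exact hK.norm_truncInversion_sub_le hf hr hr' hx

lemma continuousOn_limit (hK : OscillatoryKernel K γ C r₀) (hf : Integrable f) {L : ℝ → ℂ}
    (hL : ∀ x, 0 < x → ∀ r, r₀ ≤ r →
        ‖L x - truncInversion γ (fun u => ∫ z, K u z * f z) r x‖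
          ≤ C * (Real.exp (γ * x) / x)
            * ((∫ z, ‖f z‖) / r + ∫ z in {z : ℝ | r / 2 < |z|}, ‖f z‖)) :
    ContinuousOn L (Ioi 0) := by
  have htail : Tendsto (fun r : ℝ => (∫ z, ‖f z‖) / r + ∫ z in {z : ℝ | r / 2 < |z|}, ‖f z‖)
      atTop (𝓝 0) := by
    simpa using (tendsto_id.const_div_atTop (∫ z, ‖f z‖)).add (tendsto_setIntegral_tail hf.norm)
  have hunif : TendstoLocallyUniformlyOn
      (fun r x => truncInversion γ (fun u => ∫ z, K u z * f z) r x) L atTop (Ioi 0) := by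
    rw [Metric.tendstoLocallyUniformlyOn_iff]
    intro ε hε x (hx : 0 < x)
    have h1 := htail.const_mul (C * (Real.exp (γ * (x + 1)) / (x / 2)))
    rw [mul_zero] at h1
    refine ⟨Ioo (x / 2) (x + 1),
      mem_nhdsWithin_of_mem_nhds (Ioo_mem_nhds (by linarith) (by linarith)), ?_⟩
    filter_upwards [h1.eventually_lt_const hε, eventually_ge_atTop r₀] with r hr hr₀ y hy
    have hr0 : 0 < r := hK.r₀_pos.trans_le hr₀
    have hC := hK.C_pos
    have hγ := hK.gamma_pos
    rw [dist_eq_norm]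
    refine (hL y (by linarith [hy.1]) r hr₀).trans_lt (lt_of_le_of_lt ?_ hr)
    have hn : 0 ≤ (∫ z, ‖f z‖) / r + ∫ z in {z : ℝ | r / 2 < |z|}, ‖f z‖ :=
      add_nonneg (div_nonneg (integral_nonneg fun z => norm_nonneg _) hr0.le)
        (integral_nonneg fun z => norm_nonneg _)
    gcongr
    · exact hy.2.le
    · exact hy.1.le
  exact hunif.continuousOn (Eventually.of_forall fun r =>
    (continuous_truncInversion γ (hK.continuous_integral hf) r).continuousOn).frequently

lemma norm_sub_truncated_le (hK : OscillatoryKernel K γ C r₀) (hf : Integrable f) {r R x : ℝ}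
    (hr : 0 ≤ r) (hR : 0 ≤ R) (hx : 0 < x) :
    ‖truncInversion γ (fun u => ∫ z, K u z * f z) r x
        - truncInversion γ (fun u => ∫ z in (-R)..R, K u z * f z) r x‖
      ≤ C * (Real.exp (γ * x) / x) * ∫ z in {z : ℝ | R < |z|}, ‖f z‖ := by
  have hS : MeasurableSet {z : ℝ | R < |z|} := measurableSet_lt measurable_const measurable_norm
  have hf' : Integrable ({z : ℝ | R < |z|}.indicator f) := hf.indicator hS
  have hcompl : {z : ℝ | R < |z|}ᶜ = Icc (-R) R := by
    ext z
    simp only [mem_compl_iff, mem_ofPred_eq, not_lt, mem_Icc, abs_le]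
  have e1 : ∀ u : ℝ, (∫ z in (-R)..R, K u z * f z)
      = (∫ z, K u z * f z) - ∫ z, K u z * {z : ℝ | R < |z|}.indicator f z := fun u => by
    have e2 : ∀ z, K u z * {z : ℝ | R < |z|}.indicator f z
        = {z : ℝ | R < |z|}.indicator (fun z => K u z * f z) z := fun z =>
      (indicator_mul_right _ (fun z => K u z) f).symm
    simp only [e2]
    rw [integral_indicator hS, intervalIntegral.integral_of_le (by linarith),
      ← integral_Icc_eq_integral_Ioc, ← hcompl,
      ← integral_add_compl hS (hK.integrable_mul hf u)]
    ring
  have hc : ∀ {g : ℝ → ℂ}, Integrable g → IntervalIntegrable (fun u : ℝ =>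
      Complex.exp (((γ : ℂ) + Complex.I * (u : ℂ)) * (x : ℂ)) * ∫ z, K u z * g z)
      volume (-r) r := fun hg =>
    (Continuous.mul (by fun_prop) (hK.continuous_integral hg)).intervalIntegrable _ _
  have h := hK.norm_truncInversion_le hf' hr hx
  have e3 : ∫ z, ‖{z : ℝ | R < |z|}.indicator f z‖ = ∫ z in {z : ℝ | R < |z|}, ‖f z‖ := by
    simp only [norm_indicator_eq_indicator_norm]
    rw [integral_indicator hS]
  rw [e3] at h
  refine le_trans (le_of_eq ?_) h
  congr 1
  simp only [e1, truncInversion, mul_sub]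
  rw [intervalIntegral.integral_sub (hc hf) (hc hf')]
  ring

lemma integral_neg (hK : OscillatoryKernel K γ C r₀)
    (hf : ∀ᵐ z, f (-z) = (starRingEnd ℂ) (f z)) (u : ℝ) :
    ∫ z, K (-u) z * f z = (starRingEnd ℂ) (∫ z, K u z * f z) := by
  rw [← integral_neg_eq_self, ← integral_conj]
  refine integral_congr_ae ?_
  filter_upwards [hf] with z hz
  rw [hK.neg_neg, hz, map_mul]

end OscillatoryKernel

/-! ### Two-sided Laplace transforms of test functions -/

lemma testSeminorm_nonneg (k n : ℕ) (φ : testSpace) : 0 ≤ testSeminorm k n φ :=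
  Real.iSup_nonneg fun _ => abs_nonneg _

lemma le_testSeminorm (φ : testSpace) {k n : ℕ} (hn : n ≤ 3) (x : ℝ) :
    Real.exp (k * x) * |iteratedDeriv n (φ : ℝ → ℝ) x| ≤ testSeminorm k n φ := by
  have h := le_ciSup (φ.2.2 k n hn) x
  simp only [abs_mul, Real.abs_exp] at h
  simpa only [testSeminorm, abs_mul, Real.abs_exp] using h

/-- The two seminorms that control `e^{γ x} φ⁽ⁿ⁾(x)` for `x < 0` and for `x > 0`. -/
noncomputable def tiltedBound (γ : ℝ) (n : ℕ) (φ : testSpace) : ℝ :=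
  testSeminorm 0 n φ + testSeminorm (⌈γ⌉₊ + 1) n φ

lemma exp_mul_abs_iteratedDeriv_le {γ : ℝ} (φ : testSpace) {n : ℕ} (hn : n ≤ 3) (x : ℝ) :
    Real.exp (γ * x) * |iteratedDeriv n (φ : ℝ → ℝ) x|
      ≤ tiltedBound γ n φ * Real.exp (-min γ 1 * |x|) := by
  have h0 := le_testSeminorm φ (k := 0) hn x
  have hN := le_testSeminorm φ (k := ⌈γ⌉₊ + 1) hn x
  have hp0 := testSeminorm_nonneg 0 n φ
  have hpN := testSeminorm_nonneg (⌈γ⌉₊ + 1) n φ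
  rw [Nat.cast_zero, zero_mul, Real.exp_zero, one_mul] at h0
  rcases le_total x 0 with hx | hx
  · have h1 : Real.exp (γ * x) ≤ Real.exp (-min γ 1 * |x|) := by
      rw [abs_of_nonpos hx, neg_mul_neg]
      exact Real.exp_le_exp.mpr (mul_le_mul_of_nonpos_right (min_le_left _ _) hx)
    rw [mul_comm (tiltedBound γ n φ)]
    exact mul_le_mul h1 (h0.trans (le_add_of_nonneg_right hpN)) (abs_nonneg _) (Real.exp_pos _).le
  · have h1 : Real.exp (γ * x)
        ≤ Real.exp (-min γ 1 * |x|) * Real.exp (((⌈γ⌉₊ + 1 : ℕ) : ℝ) * x) := by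
      rw [abs_of_nonneg hx, ← Real.exp_add, Real.exp_le_exp, ← add_mul]
      refine mul_le_mul_of_nonneg_right ?_ hx
      have := Nat.le_ceil γ
      have h2 := min_le_right γ 1
      push_cast
      linarith
    calc _ ≤ Real.exp (-min γ 1 * |x|) * Real.exp (((⌈γ⌉₊ + 1 : ℕ) : ℝ) * x)
          * |iteratedDeriv n (φ : ℝ → ℝ) x| := mul_le_mul_of_nonneg_right h1 (abs_nonneg _)
      _ = Real.exp (-min γ 1 * |x|) * (Real.exp (((⌈γ⌉₊ + 1 : ℕ) : ℝ) * x)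
          * |iteratedDeriv n (φ : ℝ → ℝ) x|) := mul_assoc _ _ _
      _ ≤ Real.exp (-min γ 1 * |x|) * tiltedBound γ n φ :=
          mul_le_mul_of_nonneg_left (hN.trans (le_add_of_nonneg_left hp0)) (Real.exp_pos _).le
      _ = _ := mul_comm _ _

lemma integrable_exp_neg_mul_abs {d : ℝ} (hd : 0 < d) :
    Integrable fun x : ℝ => Real.exp (-d * |x|) := by
  rw [← integrableOn_univ, ← Iic_union_Ioi (a := (0 : ℝ))]
  refine IntegrableOn.union ?_ ?_
  · refine (integrableOn_exp_mul_Iic hd 0).congr_fun (fun x hx => ?_) measurableSet_Iic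
    rw [abs_of_nonpos hx, neg_mul_neg]
  · refine (integrableOn_exp_mul_Ioi (neg_lt_zero.mpr hd) 0).congr_fun (fun x hx => ?_)
      measurableSet_Ioi
    rw [abs_of_pos hx]

lemma continuous_iteratedDeriv_test (φ : testSpace) {n : ℕ} (hn : n ≤ 3) :
    Continuous (iteratedDeriv n (φ : ℝ → ℝ)) :=
  φ.2.1.continuous_iteratedDeriv n (by exact_mod_cast hn)

lemma hasDerivAt_iteratedDeriv_test (φ : testSpace) {n : ℕ} (hn : n < 3) (x : ℝ) :
    HasDerivAt (iteratedDeriv n (φ : ℝ → ℝ)) (iteratedDeriv (n + 1) (φ : ℝ → ℝ) x) x := by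
  rw [iteratedDeriv_succ]
  exact (φ.2.1.differentiable_iteratedDeriv n (by exact_mod_cast hn) x).hasDerivAt

/-- The two-sided Laplace transform `∫ e^{(γ + i u) x} φ⁽ⁿ⁾(x) dx` on the line `Re = γ`. -/
noncomputable def testTransform (γ : ℝ) (n : ℕ) (φ : testSpace) (u : ℝ) : ℂ :=
  ∫ x : ℝ, Complex.exp (((γ : ℂ) + Complex.I * (u : ℂ)) * (x : ℂ))
    * ((iteratedDeriv n (φ : ℝ → ℝ) x : ℝ) : ℂ)

lemma norm_testTransform_integrand_le (γ : ℝ) (φ : testSpace) {n : ℕ} (hn : n ≤ 3) (u x : ℝ) :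
    ‖Complex.exp (((γ : ℂ) + Complex.I * (u : ℂ)) * (x : ℂ))
      * ((iteratedDeriv n (φ : ℝ → ℝ) x : ℝ) : ℂ)‖
      ≤ tiltedBound γ n φ * Real.exp (-min γ 1 * |x|) := by
  rw [norm_mul, norm_exp_vertical, Complex.norm_real, Real.norm_eq_abs]
  exact exp_mul_abs_iteratedDeriv_le φ hn x

lemma integrable_testTransform_integrand {γ : ℝ} (hγ : 0 < γ) (φ : testSpace) {n : ℕ}
    (hn : n ≤ 3) (u : ℝ) :
    Integrable fun x : ℝ => Complex.exp (((γ : ℂ) + Complex.I * (u : ℂ)) * (x : ℂ))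
      * ((iteratedDeriv n (φ : ℝ → ℝ) x : ℝ) : ℂ) := by
  have hc := continuous_iteratedDeriv_test φ hn
  exact Integrable.mono' ((integrable_exp_neg_mul_abs (lt_min hγ one_pos)).const_mul _)
    (Continuous.aestronglyMeasurable (by fun_prop))
    (Eventually.of_forall fun x => norm_testTransform_integrand_le γ φ hn u x)

lemma norm_testTransform_le {γ : ℝ} (hγ : 0 < γ) (φ : testSpace) {n : ℕ} (hn : n ≤ 3) (u : ℝ) :
    ‖testTransform γ n φ u‖ ≤ tiltedBound γ n φ * ∫ x : ℝ, Real.exp (-min γ 1 * |x|) := by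
  rw [← integral_const_mul]
  exact norm_integral_le_of_norm_le
    ((integrable_exp_neg_mul_abs (lt_min hγ one_pos)).const_mul _)
    (Eventually.of_forall fun x => norm_testTransform_integrand_le γ φ hn u x)

lemma continuous_testTransform {γ : ℝ} (hγ : 0 < γ) (φ : testSpace) {n : ℕ} (hn : n ≤ 3) :
    Continuous (testTransform γ n φ) :=
  continuous_of_dominated
    (fun u => (integrable_testTransform_integrand hγ φ hn u).aestronglyMeasurable)
    (fun u => Eventually.of_forall fun x => norm_testTransform_integrand_le γ φ hn u x)
    ((integrable_exp_neg_mul_abs (lt_min hγ one_pos)).const_mul _)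
    (Eventually.of_forall fun x => by fun_prop)

lemma testTransform_succ {γ : ℝ} (hγ : 0 < γ) (φ : testSpace) {n : ℕ} (hn : n < 3) (u : ℝ) :
    testTransform γ (n + 1) φ u = -(((γ : ℂ) + Complex.I * (u : ℂ)) * testTransform γ n φ u) := by
  have i₀ := integrable_testTransform_integrand hγ φ hn.le u
  have i₁ := integrable_testTransform_integrand hγ φ (n := n + 1) hn u
  have hderiv : ∀ x : ℝ, HasDerivAt
      (fun x : ℝ => Complex.exp (((γ : ℂ) + Complex.I * (u : ℂ)) * (x : ℂ))
        * ((iteratedDeriv n (φ : ℝ → ℝ) x : ℝ) : ℂ))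
      (((γ : ℂ) + Complex.I * (u : ℂ)) * (Complex.exp (((γ : ℂ) + Complex.I * (u : ℂ)) * (x : ℂ))
        * ((iteratedDeriv n (φ : ℝ → ℝ) x : ℝ) : ℂ))
      + Complex.exp (((γ : ℂ) + Complex.I * (u : ℂ)) * (x : ℂ))
        * ((iteratedDeriv (n + 1) (φ : ℝ → ℝ) x : ℝ) : ℂ)) x := fun x => by
    have h1 : HasDerivAt (fun x : ℝ => ((γ : ℂ) + Complex.I * (u : ℂ)) * (x : ℂ))
        ((γ : ℂ) + Complex.I * (u : ℂ)) x := by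
      simpa using (Complex.ofRealCLM.hasDerivAt (x := x)).const_mul ((γ : ℂ) + Complex.I * (u : ℂ))
    refine (h1.cexp.mul (hasDerivAt_iteratedDeriv_test φ hn x).ofReal_comp).congr_deriv ?_
    ring
  have h := integral_eq_zero_of_hasDerivAt_of_integrable hderiv ((i₀.const_mul _).add i₁) i₀
  rw [integral_add (i₀.const_mul _) i₁, integral_const_mul] at h
  exact eq_neg_of_add_eq_zero_right h

/-- Two integrations by parts give quadratic decay along the line `Re = γ`. -/
lemma norm_testTransform_zero_le {γ : ℝ} (hγ : 0 < γ) (φ : testSpace) (u : ℝ) :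
    ‖testTransform γ 0 φ u‖ ≤ tiltedBound γ 2 φ * (∫ x : ℝ, Real.exp (-min γ 1 * |x|))
      * (min (γ ^ 2) 1)⁻¹ * (1 + u ^ 2)⁻¹ := by
  have h1 := testTransform_succ hγ φ (n := 0) (by norm_num) u
  have h2 := testTransform_succ hγ φ (n := 1) (by norm_num) u
  have h3 : testTransform γ 2 φ u
      = ((γ : ℂ) + Complex.I * (u : ℂ)) ^ 2 * testTransform γ 0 φ u := by
    rw [zero_add] at h1
    rw [h2, h1]; ring
  have h4 := norm_testTransform_le hγ φ (n := 2) (by norm_num) u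
  have h5 : ‖((γ : ℂ) + Complex.I * (u : ℂ)) ^ 2‖ = γ ^ 2 + u ^ 2 := by
    rw [norm_pow, Complex.sq_norm, Complex.normSq_apply]
    simp
    ring
  have h6 : min (γ ^ 2) 1 * (1 + u ^ 2) ≤ γ ^ 2 + u ^ 2 := by
    have e1 := min_le_left (γ ^ 2) 1
    have e2 := mul_le_mul_of_nonneg_right (min_le_right (γ ^ 2) 1) (sq_nonneg u)
    linarith
  have hm : 0 < min (γ ^ 2) 1 := lt_min (by positivity) one_pos
  rw [h3, norm_mul, h5] at h4
  rw [← div_eq_mul_inv, ← div_eq_mul_inv, div_div, le_div_iff₀ (by positivity), mul_comm]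
  exact (mul_le_mul_of_nonneg_right h6 (norm_nonneg _)).trans h4

/-! ### The limit functional -/

section Functional

variable {γ M : ℝ} {H : ℝ → ℂ}

lemma integrable_mul_testTransform (hγ : 0 < γ) (hH : Continuous H) (hM : ∀ u, ‖H u‖ ≤ M)
    (φ : testSpace) : Integrable fun u => H u * testTransform γ 0 φ u := by
  refine Integrable.bdd_mul (c := M) ?_ hH.aestronglyMeasurable (Eventually.of_forall hM)
  exact Integrable.mono' (integrable_inv_one_add_sq.const_mul _)
    (continuous_testTransform hγ φ (by norm_num)).aestronglyMeasurable
    (Eventually.of_forall fun u => norm_testTransform_zero_le hγ φ u)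

lemma testTransform_add (hγ : 0 < γ) (φ χ : testSpace) (u : ℝ) :
    testTransform γ 0 (φ + χ) u = testTransform γ 0 φ u + testTransform γ 0 χ u := by
  simp only [testTransform]
  rw [← integral_add (integrable_testTransform_integrand hγ φ (Nat.zero_le 3) u)
    (integrable_testTransform_integrand hγ χ (Nat.zero_le 3) u)]
  refine integral_congr_ae (Eventually.of_forall fun x => ?_)
  simp only [iteratedDeriv_zero, Submodule.coe_add, Pi.add_apply, Complex.ofReal_add, mul_add]

lemma testTransform_smul (c : ℝ) (φ : testSpace) (u : ℝ) :
    testTransform γ 0 (c • φ) u = (c : ℂ) * testTransform γ 0 φ u := by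
  simp only [testTransform]
  rw [← integral_const_mul]
  refine integral_congr_ae (Eventually.of_forall fun x => ?_)
  simp only [iteratedDeriv_zero, Submodule.coe_smul, Pi.smul_apply, smul_eq_mul,
    Complex.ofReal_mul]
  ring

/-- The weak limit of the truncated inversions of `H`: the functional
`φ ↦ (1 / 2π) ∫ H(u) ∫ e^{(γ + i u) x} φ(x) dx du`. The real part makes it real valued for every
bounded continuous `H`; for Hermitian `H` nothing is lost. -/
noncomputable def inversionFunctional (hγ : 0 < γ) (hH : Continuous H) (hM : ∀ u, ‖H u‖ ≤ M) :
    testSpace →ₗ[ℝ] ℝ where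
  toFun φ := ((1 / (2 * (Real.pi : ℂ))) * ∫ u, H u * testTransform γ 0 φ u).re
  map_add' φ χ := by
    simp only [testTransform_add hγ, mul_add]
    rw [integral_add (integrable_mul_testTransform hγ hH hM φ)
      (integrable_mul_testTransform hγ hH hM χ), mul_add, Complex.add_re]
  map_smul' c φ := by
    simp only [testTransform_smul, mul_left_comm _ (c : ℂ), RingHom.id_apply, smul_eq_mul]
    rw [integral_const_mul, mul_left_comm, Complex.re_ofReal_mul]

lemma isContinuousFunctional_inversionFunctional (hγ : 0 < γ) (hH : Continuous H)
    (hM : ∀ u, ‖H u‖ ≤ M) : IsContinuousFunctional (inversionFunctional hγ hH hM) := by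
  have hM0 : 0 ≤ M := (norm_nonneg _).trans (hM 0)
  set A := (∫ x : ℝ, Real.exp (-min γ 1 * |x|)) * (min (γ ^ 2) 1)⁻¹ with hA
  have hA0 : 0 ≤ A := mul_nonneg (integral_nonneg fun x => (Real.exp_pos _).le)
    (inv_nonneg.mpr (le_min (by positivity) zero_le_one))
  refine ⟨⌈γ⌉₊ + 1, 2 * (M * A * ∫ u : ℝ, (1 + u ^ 2)⁻¹), fun φ => ?_⟩
  have hI : 0 ≤ ∫ u : ℝ, (1 + u ^ 2)⁻¹ := integral_nonneg fun u => by positivity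
  have h1 : ‖∫ u, H u * testTransform γ 0 φ u‖
      ≤ M * A * (∫ u : ℝ, (1 + u ^ 2)⁻¹) * tiltedBound γ 2 φ := by
    have h2 : M * A * (∫ u : ℝ, (1 + u ^ 2)⁻¹) * tiltedBound γ 2 φ
        = ∫ u : ℝ, (M * A * tiltedBound γ 2 φ) * (1 + u ^ 2)⁻¹ := by
      rw [integral_const_mul]; ring
    rw [h2]
    refine norm_integral_le_of_norm_le (integrable_inv_one_add_sq.const_mul _)
      (Eventually.of_forall fun u => ?_)
    rw [norm_mul]
    refine (mul_le_mul (hM u) (norm_testTransform_zero_le hγ φ u) (norm_nonneg _)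
      hM0).trans (le_of_eq ?_)
    rw [hA]; ring
  have hle : ∀ k ∈ Finset.range (⌈γ⌉₊ + 1 + 1), testSeminorm k 2 φ
      ≤ ∑ k ∈ Finset.range (⌈γ⌉₊ + 1 + 1), ∑ n ∈ Finset.range 4, testSeminorm k n φ :=
    fun k hk => (Finset.single_le_sum (f := fun n => testSeminorm k n φ)
      (fun n _ => testSeminorm_nonneg k n φ) (Finset.mem_range.mpr (by norm_num))).trans
      (Finset.single_le_sum (f := fun k => ∑ n ∈ Finset.range 4, testSeminorm k n φ)
        (fun k _ => Finset.sum_nonneg fun n _ => testSeminorm_nonneg k n φ) hk)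
  have h3 := hle 0 (Finset.mem_range.mpr (by omega))
  have h4 := hle (⌈γ⌉₊ + 1) (Finset.mem_range.mpr (by omega))
  have h5 := (Complex.abs_re_le_norm _).trans
    (norm_one_div_two_pi_mul_le (∫ u, H u * testTransform γ 0 φ u))
  refine h5.trans ?_
  have h6 : 0 ≤ M * A * ∫ u : ℝ, (1 + u ^ 2)⁻¹ := by positivity
  have h7 : tiltedBound γ 2 φ ≤ 2 * ∑ k ∈ Finset.range (⌈γ⌉₊ + 1 + 1),
      ∑ n ∈ Finset.range 4, testSeminorm k n φ := by
    rw [tiltedBound]; linarith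
  have h8 := mul_le_mul_of_nonneg_left h7 h6
  have h9 := norm_nonneg (∫ u, H u * testTransform γ 0 φ u)
  linarith

/-- Pairing the truncated inversion with a test function, by Fubini's theorem. -/
lemma integrable_and_integral_truncInversion_mul (hγ : 0 < γ) (hH : Continuous H)
    (hM : ∀ u, ‖H u‖ ≤ M) (φ : testSpace) (r : ℝ) :
    Integrable (fun x : ℝ => truncInversion γ H r x * ((φ : ℝ → ℝ) x : ℂ)) ∧
      ∫ x : ℝ, truncInversion γ H r x * ((φ : ℝ → ℝ) x : ℂ)
        = (1 / (2 * (Real.pi : ℂ))) * ∫ u in (-r)..r, H u * testTransform γ 0 φ u := by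
  have hφ : Continuous (φ : ℝ → ℝ) := φ.2.1.continuous
  have i₀ := integrable_testTransform_integrand hγ φ (Nat.zero_le 3) 0
  simp only [iteratedDeriv_zero] at i₀
  have hint : Integrable (Function.uncurry fun (u x : ℝ) =>
      Complex.exp (((γ : ℂ) + Complex.I * (u : ℂ)) * (x : ℂ)) * H u * ((φ : ℝ → ℝ) x : ℂ))
      ((volume.restrict (uIoc (-r) r)).prod volume) := by
    have hone : Integrable (fun _ : ℝ => (1 : ℂ)) (volume.restrict (uIoc (-r) r)) :=
      integrable_const_iff.mpr (Or.inr ⟨by simp [uIoc, Measure.restrict_apply]⟩)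
    refine Integrable.mono' ((hone.norm.const_mul M).mul_prod i₀.norm)
      (Continuous.aestronglyMeasurable ?_) (Eventually.of_forall fun q => ?_)
    · simp only [Function.uncurry_def]
      fun_prop
    · simp only [Function.uncurry, norm_mul, norm_exp_vertical, norm_one, mul_one]
      calc _ = ‖H q.1‖ * (Real.exp (γ * q.2) * ‖((φ : ℝ → ℝ) q.2 : ℂ)‖) := by ring
        _ ≤ _ := mul_le_mul_of_nonneg_right (hM _) (by positivity)
  have e : ∀ x : ℝ, truncInversion γ H r x * ((φ : ℝ → ℝ) x : ℂ)
      = (1 / (2 * (Real.pi : ℂ))) * ∫ u in (-r)..r,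
        Complex.exp (((γ : ℂ) + Complex.I * (u : ℂ)) * (x : ℂ)) * H u * ((φ : ℝ → ℝ) x : ℂ) :=
    fun x => by
      rw [truncInversion, intervalIntegral.integral_mul_const, mul_assoc]
  simp only [e]
  constructor
  · refine Integrable.const_mul ?_ _
    simp only [intervalIntegral.intervalIntegral_eq_integral_uIoc]
    exact hint.integral_prod_right.smul _
  · rw [integral_const_mul, ← intervalIntegral_integral_swap hint]
    congr 2
    funext u
    rw [testTransform, ← integral_const_mul]
    refine integral_congr_ae (Eventually.of_forall fun x => ?_)
    simp only [iteratedDeriv_zero]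
    ring

end Functional

/-! ### Realness of the inversion -/

open scoped ContDiff in
/-- An integrable function whose Fourier integral vanishes identically is zero: it is orthogonal to
the Fourier transforms of all Schwartz functions, hence to all smooth compactly supported ones. -/
lemma ae_eq_zero_of_fourier_eq_zero {f : ℝ → ℂ} (hf : Integrable f)
    (h : ∀ x : ℝ, ∫ z : ℝ, Complex.exp (-(Complex.I * (x : ℂ) * (z : ℂ))) * f z = 0) :
    ∀ᵐ z, f z = 0 := by
  have hF : ∀ w : ℝ, FourierTransform.fourier f w = 0 := fun w => by
    rw [Real.fourier_real_eq_integral_exp_smul, ← h (2 * Real.pi * w)]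
    refine integral_congr_ae (Eventually.of_forall fun z => ?_)
    simp only [smul_eq_mul]
    congr 2
    push_cast
    ring
  refine ae_eq_zero_of_integral_contDiff_smul_eq_zero hf.locallyIntegrable fun g hg hgc => ?_
  have hg₁ : HasCompactSupport (Complex.ofRealCLM ∘ g) := hgc.comp_left rfl
  have hg₂ : ContDiff ℝ ∞ (Complex.ofRealCLM ∘ g) := by fun_prop
  set G : SchwartzMap ℝ ℂ := hg₁.toSchwartzMap hg₂ with hG
  set P : SchwartzMap ℝ ℂ := FourierTransformInv.fourierInv G with hP
  have hPG : FourierTransform.fourier P = G := FourierTransform.fourier_fourierInv_eq G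
  have key := VectorFourier.integral_bilin_fourierIntegral_eq_flip (ContinuousLinearMap.lsmul ℂ ℂ)
    (L := innerₗ ℝ) (μ := volume) (ν := volume) Real.continuous_fourierChar continuous_inner
    hf P.integrable
  have key' : ∫ ξ, FourierTransform.fourier f ξ * P ξ
      = ∫ x, f x * FourierTransform.fourier (P : ℝ → ℂ) x := by
    simpa using! key
  simp only [hF, zero_mul, integral_zero] at key'
  rw [← SchwartzMap.fourier_coe, hPG] at key'
  rw [key']
  refine integral_congr_ae (Eventually.of_forall fun x => ?_)
  have : G x = (g x : ℂ) := rfl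
  simp only [this, Complex.real_smul, mul_comm]

lemma PayoffAssumption.hermitian {ζ : ℝ} {h : ℝ → ℝ} {hhat : ℝ → ℂ}
    (hP : PayoffAssumption ζ h hhat) : ∀ᵐ z, hhat (-z) = (starRingEnd ℂ) (hhat z) := by
  have hi := hP.integrable
  have hc : Integrable fun z => (starRingEnd ℂ) (hhat z) :=
    hi.norm.mono' (Complex.continuous_conj.comp_aestronglyMeasurable hi.aestronglyMeasurable)
      (Eventually.of_forall fun z => by simp)
  have hn : Integrable fun z => hhat (-z) := hi.comp_neg
  have hzero := ae_eq_zero_of_fourier_eq_zero (hn.sub hc) fun x => by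
    have hb : ∀ {f : ℝ → ℂ}, Integrable f → Integrable fun z : ℝ =>
        Complex.exp (-(Complex.I * (x : ℂ) * (z : ℂ))) * f z := fun hf => by
      refine hf.bdd_mul (c := 1) (Continuous.aestronglyMeasurable (by fun_prop))
        (Eventually.of_forall fun z => ?_)
      rw [Complex.norm_exp]
      simp
    simp only [Pi.sub_apply, mul_sub]
    rw [integral_sub (hb hn) (hb hc), sub_eq_zero]
    have e1 : ∫ z : ℝ, Complex.exp (-(Complex.I * (x : ℂ) * (z : ℂ))) * hhat (-z)
        = ((Real.exp (ζ * (-x)) * h (-x) : ℝ) : ℂ) := by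
      rw [hP.fourier (-x), ← integral_neg_eq_self]
      refine integral_congr_ae (Eventually.of_forall fun z => ?_)
      simp
    have e2 : ∫ z : ℝ, Complex.exp (-(Complex.I * (x : ℂ) * (z : ℂ))) * (starRingEnd ℂ) (hhat z)
        = (starRingEnd ℂ) ((Real.exp (ζ * (-x)) * h (-x) : ℝ) : ℂ) := by
      rw [hP.fourier (-x), ← integral_conj]
      refine integral_congr_ae (Eventually.of_forall fun z => ?_)
      simp only [map_mul, ← Complex.exp_conj]
      simp
    rw [e1, e2, Complex.conj_ofReal]
  filter_upwards [hzero] with z hz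
  exact sub_eq_zero.mp hz

/-! ### The weak symmetry image -/

/-- The truncated inversions of an oscillatory kernel against a Hermitian amplitude converge to a
weak symmetry image, at the rate dictated by the oscillatory integrals. -/
theorem OscillatoryKernel.exists_isWeakSymmetryImage {ψ : ℂ → ℂ} {ζ γ C r₀ : ℝ}
    (hK : OscillatoryKernel (fun u z => kernel ψ ζ ((γ : ℂ) + Complex.I * (u : ℂ)) z) γ C r₀)
    {f : ℝ → ℂ} (hf : Integrable f) (hherm : ∀ᵐ z, f (-z) = (starRingEnd ℂ) (f z)) :
    ∃ g : ℝ → ℝ, IsWeakSymmetryImage ψ ζ γ f g ∧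
      ∀ r : ℝ, r₀ ≤ r → ∀ R : ℝ, 1 ≤ R → ∀ x : ℝ, 0 < x →
        ‖(g x : ℂ) - truncUZ ψ ζ γ f r R x‖
          ≤ 2 * C * (Real.exp (γ * x) / x) * ((∫ z : ℝ, ‖f z‖) / r
            + ∫ z in {z : ℝ | min (r / 2) R < |z|}, ‖f z‖) := by
  set H : ℝ → ℂ := fun u => ∫ z, kernel ψ ζ ((γ : ℂ) + Complex.I * (u : ℂ)) z * f z with hH
  have hγ := hK.gamma_pos
  have hHc : Continuous H := hK.continuous_integral hf
  have hHM : ∀ u, ‖H u‖ ≤ C * ∫ z, ‖f z‖ := hK.norm_integral_le hf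
  have hreal : ∀ r x, ((truncInversion γ H r x).re : ℂ) = truncInversion γ H r x := fun r x =>
    Complex.conj_eq_iff_re.mp (conj_truncInversion γ (hK.integral_neg hherm) r x)
  obtain ⟨L, hL, hLr⟩ := hK.exists_limit hf
  have hLreal : ∀ x, 0 < x → ((L x).re : ℂ) = L x := fun x hx => by
    refine tendsto_nhds_unique ?_ (hL x hx)
    have h1 := (Complex.continuous_ofReal.comp Complex.continuous_re).continuousAt.tendsto.comp
      (hL x hx)
    exact h1.congr fun r => hreal r x
  refine ⟨fun x => (L x).re, ⟨?_, ?_, inversionFunctional hγ hHc hHM,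
    isContinuousFunctional_inversionFunctional hγ hHc hHM, ?_⟩, ?_⟩
  · exact Complex.continuous_re.comp_continuousOn (hK.continuousOn_limit hf hLr)
  · intro x hx
    rw [hLreal x hx]
    exact hL x hx
  · have hpair := integrable_and_integral_truncInversion_mul hγ hHc hHM
    have hweak : ∀ φ : testSpace, Tendsto
        (fun r : ℝ => ∫ x : ℝ, truncInversion γ H r x * ((φ : ℝ → ℝ) x : ℂ)) atTop
        (𝓝 (inversionFunctional hγ hHc hHM φ : ℂ)) := fun φ => by
      have h1 : Tendsto
          (fun r : ℝ => ∫ x : ℝ, truncInversion γ H r x * ((φ : ℝ → ℝ) x : ℂ)) atTop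
          (𝓝 ((1 / (2 * (Real.pi : ℂ))) * ∫ u, H u * testTransform γ 0 φ u)) := by
        simp only [fun r => (hpair φ r).2]
        exact (intervalIntegral_tendsto_integral (integrable_mul_testTransform hγ hHc hHM φ)
          tendsto_neg_atTop_atBot tendsto_id).const_mul _
      have h2 : ∀ r : ℝ, ((∫ x : ℝ, truncInversion γ H r x * ((φ : ℝ → ℝ) x : ℂ)).re : ℂ)
          = ∫ x : ℝ, truncInversion γ H r x * ((φ : ℝ → ℝ) x : ℂ) := fun r => by
        have : ∀ x : ℝ, truncInversion γ H r x * ((φ : ℝ → ℝ) x : ℂ)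
            = (((truncInversion γ H r x).re * (φ : ℝ → ℝ) x : ℝ) : ℂ) := fun x => by
          rw [Complex.ofReal_mul, hreal]
        simp only [this]
        rw [integral_complex_ofReal, Complex.ofReal_re]
      have h3 := (Complex.continuous_ofReal.comp Complex.continuous_re).continuousAt.tendsto.comp h1
      exact h3.congr h2
    refine ⟨fun φ => ⟨fun r _ => (hpair φ r).1, hweak φ⟩, fun φ hφc hφs => ?_⟩
    -- on the compact support of `φ` the truncated inversions are uniformly bounded
    have hlim : Tendsto
        (fun r : ℝ => ∫ x : ℝ, truncInversion γ H r x * ((φ : ℝ → ℝ) x : ℂ)) atTop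
        (𝓝 (∫ x : ℝ, (((L x).re * (φ : ℝ → ℝ) x : ℝ) : ℂ))) := by
      have hsupp : ∀ x, (φ : ℝ → ℝ) x ≠ 0 → 0 < x := fun x hx =>
        hφs (subset_tsupport _ hx)
      have hbc : ContinuousOn (fun x : ℝ => C * (Real.exp (γ * x) / x) * ∫ z, ‖f z‖)
          (tsupport (φ : ℝ → ℝ)) := by
        refine ContinuousOn.mul (ContinuousOn.mul continuousOn_const
          (ContinuousOn.div (by fun_prop) continuousOn_id fun x hx => ?_)) continuousOn_const
        exact (hφs hx).ne'
      obtain ⟨M, hM⟩ := hφc.isCompact.exists_bound_of_continuousOn hbc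
      refine tendsto_integral_filter_of_dominated_convergence
        (fun x => M * ‖((φ : ℝ → ℝ) x : ℂ)‖)
        (Eventually.of_forall fun r => (hpair φ r).1.aestronglyMeasurable) ?_ ?_ ?_
      · filter_upwards [eventually_ge_atTop 0] with r hr
        refine Eventually.of_forall fun x => ?_
        rw [norm_mul]
        by_cases hx : (φ : ℝ → ℝ) x = 0
        · simp [hx]
        · refine mul_le_mul_of_nonneg_right ?_ (norm_nonneg _)
          exact (hK.norm_truncInversion_le hf hr (hsupp x hx)).trans
            ((le_abs_self _).trans (hM x (subset_tsupport _ hx)))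
      · have h1 : Integrable (φ : ℝ → ℝ) := φ.2.1.continuous.integrable_of_hasCompactSupport hφc
        simpa only [Complex.norm_real] using h1.norm.const_mul M
      · refine Eventually.of_forall fun x => ?_
        by_cases hx : (φ : ℝ → ℝ) x = 0
        · simp [hx]
        · rw [Complex.ofReal_mul, hLreal x (hsupp x hx)]
          exact (hL x (hsupp x hx)).mul_const _
    have h := tendsto_nhds_unique (hweak φ) hlim
    rw [integral_complex_ofReal] at h
    exact_mod_cast h
  · intro r hr R hR x hx
    have hr0 : 0 < r := hK.r₀_pos.trans_le hr
    have h1 := hLr x hx r hr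
    have h2 := hK.norm_sub_truncated_le hf hr0.le (zero_le_one.trans hR) hx
    have hmono : ∀ a : ℝ, min (r / 2) R ≤ a → ∫ z in {z : ℝ | a < |z|}, ‖f z‖
        ≤ ∫ z in {z : ℝ | min (r / 2) R < |z|}, ‖f z‖ := fun a ha =>
      setIntegral_mono_set hf.norm.integrableOn (Eventually.of_forall fun z => norm_nonneg _)
        (Eventually.of_forall fun z (hz : a < |z|) => ha.trans_lt hz)
    have h3 := hmono (r / 2) (min_le_left _ _)
    have h4 := hmono R (min_le_right _ _)
    have hc : 0 ≤ C * (Real.exp (γ * x) / x) := by have := hK.C_pos; positivity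
    have h5 : 0 ≤ (∫ z : ℝ, ‖f z‖) / r :=
      div_nonneg (integral_nonneg fun z => norm_nonneg _) hr0.le
    beta_reduce
    rw [hLreal x hx]
    have h6 := norm_sub_le_norm_sub_add_norm_sub (L x) (truncInversion γ H r x)
      (truncUZ ψ ζ γ f r R x)
    have h7 := mul_le_mul_of_nonneg_left h3 hc
    have h8 := mul_le_mul_of_nonneg_left h4 hc
    have h9 := mul_nonneg hc h5
    change ‖truncInversion γ H r x - truncUZ ψ ζ γ f r R x‖ ≤ _ at h2
    rw [mul_add] at h1
    calc _ ≤ _ := h6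
      _ ≤ _ := add_le_add h1 h2
      _ ≤ _ := by nlinarith

end WeakReflection

theorem corollary2 (m σ ζ : ℝ) (ν : MeasureTheory.Measure ℝ)
    (hX : WeakReflection.LevyAssumption m σ ζ ν) :
    ∃ R₁ : ℝ,
      WeakReflection.IsAdmissibleAbscissa (WeakReflection.laplaceExponent m σ ν) ζ R₁ ∧
      ∀ γ : ℝ, R₁ < γ →
        ∃ c : ℝ, 0 < c ∧ ∃ r₀ : ℝ, 0 < r₀ ∧ ∃ R₀ : ℝ, 0 < R₀ ∧
          ∀ (h : ℝ → ℝ) (hhat : ℝ → ℂ), WeakReflection.PayoffAssumption ζ h hhat →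
            ∃ g : ℝ → ℝ,
              WeakReflection.IsWeakSymmetryImage
                (WeakReflection.laplaceExponent m σ ν) ζ γ hhat g ∧
              ∀ r : ℝ, r₀ ≤ r → ∀ R : ℝ, R₀ ≤ R → ∀ x : ℝ, 0 < x →
                ‖(g x : ℂ) -
                    WeakReflection.truncUZ (WeakReflection.laplaceExponent m σ ν) ζ γ hhat r R x‖
                  ≤ c * (Real.exp (γ * x) / x) *
                    ((∫ z : ℝ, ‖hhat z‖) / r
                      + ∫ z in {z : ℝ | min (r / 2) R < |z|}, ‖hhat z‖) := by
  obtain ⟨R₁, C, K, B⟩ := hX.exists_secantBounds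
  refine ⟨R₁, B.isAdmissibleAbscissa, fun γ hγ => ?_⟩
  obtain ⟨A, r₀, hK⟩ := B.exists_oscillatoryKernel hγ
  exact ⟨2 * A, mul_pos two_pos hK.C_pos, r₀, hK.r₀_pos, 1, one_pos, fun h hhat hP =>
    hK.exists_isWeakSymmetryImage hP.integrable hP.hermitian⟩
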